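/- Let $m\ge 2$ be an integer. Let $P_k(z)=\frac{1}{2^kk!}\frac{d^k}{dz^k}(z^2-1)^k$ be the Legendre polynomials and $T_k$ the Chebyshev polynomials of the first kind. Call $\eta>0$ admissible if $P_{m-1}(z)\ge\frac12$ and $0<P_{m-1}'(z)\le\frac12m(m-1)$ for $\frac1{1+\eta}\le z\le1$, and call $\zeta>0$ admissible if $\frac12\le T_{m-1}(z)\le1$ and $0<T_{m-1}'(z)\le(m-1)^2$ for $\frac1{1+\zeta}\le z\le1$. Then admissible $\eta$ and admissible $\zeta$ exist. Moreover, for every admissible $\eta$ and every admissible $\zeta$ the following holds. Put $$C_{1,m}=m(m-1),\qquad C_{2,m}=m-\frac38+\frac{5\zeta(m-1)^2}{3},\qquad \delta=\max\Big\{\frac2\eta,\frac2\zeta\Big\}.$$ Let $R>0$, $\kappa>0$, $f\in C^2(0,\infty)$, $g\in C^1(0,\infty)$, and $$\Sigma_1=\{(r,t)\in(0,\infty)^2:\ r-t\ge\max\{R,\delta t\}\}.$$ For an integer $n$, let $u^0\in C^2((0,\infty)\times[0,\infty))$ be a solution of $$u^0_{tt}-\frac{n-1}{r}u^0_r-u^0_{rr}=0\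 \text{ in }(0,\infty)\times[0,\infty),\qquad u^0(r,0)=f(r),\quad u^0_t(r,0)=g(r)\ \text{ for } r>0.$$ (i) Let $n=2m+1$. Suppose that there is a constant $C>0$ such that either $$f(r)\ge\frac{C}{(1+r)^{\kappa}},\quad g(r)>0,\quad -C_{1,m}\frac{f(r)}r+g(r)>0\qquad\text{for all } r\ge R,$$ or $$f(r)>0,\quad g(r)>0,\quad -C_{1,m}\frac{f(r)}r+g(r)\ge\frac{C}{(1+r)^{1+\kappa}}\qquad\text{for all } r\ge R.$$ Then for all $(r,t)\in\Sigma_1$ $$u^0(r,t)\ge\frac1{2r^m}\Big\{f(r+t)(r+t)^m+f(r-t)(r-t)^m\Big\}+\frac1{4r^m}\int_{r-t}^{r+t}\lambda^m\Big(-C_{1,m}\frac{f(\lambda)}\lambda+g(\lambda)\Big)\,d\lambda.$$ (ii) Let $n=2m$. Suppose that there is a constant $C>0$ such that $$f(r)>0,\quad g(r)>0,\quad -C_{2,m}\frac{f(r)}r-|f'(r)|+\frac12g(r)\ge\frac{C}{(1+r)^{1+\kappa}}\qquad\text{for all } r\ge R.$$ Then for all $(r,t)\in\Sigma_1$ $$u^0(r,t)\ge\frac1{\pi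 r^{m-1}}\int_0^t\frac{\rho\,d\rho}{\sqrt{t^2-\rho^2}}\int_{r-\rho}^{r+\rho}\Big\{-2C_{2,m}\frac{f(\lambda)}\lambda-2|f'(\lambda)|+g(\lambda)\Big\}\frac{\lambda^m\,d\lambda}{\sqrt{\lambda^2-(r-\rho)^2}\sqrt{(r+\rho)^2-\lambda^2}},$$ where the inner integral (for each $0<\rho\le t$) and the outer integral converge absolutely. -/

import Mathlib

open Set MeasureTheory

noncomputable section

namespace RadialWave

/-- The Legendre polynomial `P_k`, by the Rodrigues formula
`P_k(z) = (1 / (2^k k!)) d^k/dz^k (z^2 - 1)^k`. -/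
def legendre (k : ℕ) : Polynomial ℝ :=
  Polynomial.C (1 / (2 ^ k * (k.factorial : ℝ))) *
    (Polynomial.derivative)^[k] ((Polynomial.X ^ 2 - 1) ^ k)

/-- `η` is an admissible constant `η_m` for the Legendre polynomial `P_{m-1}` (`m ≥ 2`): `η > 0`,
`P_{m-1} ≥ 1/2` and `0 < P_{m-1}' ≤ m(m-1)/2` on `[1/(1+η), 1]`. -/
def LegendreConst (m : ℕ) (η : ℝ) : Prop :=
  0 < η ∧ ∀ z ∈ Icc (1 / (1 + η)) 1,
    1 / 2 ≤ (legendre (m - 1)).eval z ∧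
    0 < (legendre (m - 1)).derivative.eval z ∧
    (legendre (m - 1)).derivative.eval z ≤ 1 / 2 * (m : ℝ) * ((m : ℝ) - 1)

/-- `ζ` is an admissible constant `ζ_m` for the Chebyshev polynomial (of the first kind) `T_{m-1}`
(`m ≥ 2`): `ζ > 0`, `1/2 ≤ T_{m-1} ≤ 1` and `0 < T_{m-1}' ≤ (m-1)^2` on `[1/(1+ζ), 1]`. -/
def ChebyshevConst (m : ℕ) (ζ : ℝ) : Prop :=
  0 < ζ ∧ ∀ z ∈ Icc (1 / (1 + ζ)) 1,
    1 / 2 ≤ (Polynomial.Chebyshev.T ℝ ((m : ℤ) - 1)).eval z ∧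
    (Polynomial.Chebyshev.T ℝ ((m : ℤ) - 1)).eval z ≤ 1 ∧
    0 < (Polynomial.Chebyshev.T ℝ ((m : ℤ) - 1)).derivative.eval z ∧
    (Polynomial.Chebyshev.T ℝ ((m : ℤ) - 1)).derivative.eval z ≤ ((m : ℝ) - 1) ^ 2

/-- `C_{1,m} = m(m-1)`. -/
def C1 (m : ℕ) : ℝ := (m : ℝ) * ((m : ℝ) - 1)

/-- `C_{2,m} = m - 3/8 + 5 ζ (m-1)^2 / 3`. -/
def C2 (m : ℕ) (ζ : ℝ) : ℝ := (m : ℝ) - 3 / 8 + 5 * ζ * ((m : ℝ) - 1) ^ 2 / 3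

/-- `δ = max {2/η, 2/ζ}`. -/
def delta (η ζ : ℝ) : ℝ := max (2 / η) (2 / ζ)

/-- `Σ_1 = {(r,t) ∈ (0,∞)^2 : r - t ≥ max {R, δ t}}`. -/
def Sigma1 (R δ : ℝ) : Set (ℝ × ℝ) :=
  {p | 0 < p.1 ∧ 0 < p.2 ∧ max R (δ * p.2) ≤ p.1 - p.2}

/-- First alternative for the data in dimension `2m+1`. -/
def OddData1 (m : ℕ) (R κ : ℝ) (f g : ℝ → ℝ) : Prop :=
  ∃ c > 0, ∀ r ≥ R,
    c / (1 + r) ^ κ ≤ f r ∧ 0 < g r ∧ 0 < -C1 m * (f r / r) + g r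

/-- Second alternative for the data in dimension `2m+1`. -/
def OddData2 (m : ℕ) (R κ : ℝ) (f g : ℝ → ℝ) : Prop :=
  ∃ c > 0, ∀ r ≥ R,
    0 < f r ∧ 0 < g r ∧ c / (1 + r) ^ (1 + κ) ≤ -C1 m * (f r / r) + g r

/-- The condition on the data in dimension `2m`. -/
def EvenData (m : ℕ) (ζ R κ : ℝ) (f g : ℝ → ℝ) : Prop :=
  ∃ c > 0, ∀ r ≥ R,
    0 < f r ∧ 0 < g r ∧
      c / (1 + r) ^ (1 + κ) ≤ -C2 m ζ * (f r / r) - |deriv f r| + 1 / 2 * g r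

/-- `u(r,t)` is a classical solution, of class `C^2` on `(0,∞) × [0,∞)` (up to `t = 0`), of
`u_tt - ((n-1)/r) u_r - u_rr = 0`, `u(r,0) = f(r)`, `u_t(r,0) = g(r)`.
By continuity of the second derivatives the equation for `t > 0` also gives it at `t = 0`.
No condition is imposed at `r = 0`. -/
structure IsRadialFreeSolution (n : ℕ) (f g : ℝ → ℝ) (u : ℝ → ℝ → ℝ) : Prop where
  contDiffOn : ContDiffOn ℝ 2 (fun p : ℝ × ℝ => u p.1 p.2) (Ioi 0 ×ˢ Ici 0)
  wave : ∀ r > 0, ∀ t > 0,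
    deriv (deriv fun s => u r s) t - ((n : ℝ) - 1) / r * deriv (fun x => u x t) r
      - deriv (deriv fun x => u x t) r = 0
  init_pos : ∀ r > 0, u r 0 = f r
  init_vel : ∀ r > 0, HasDerivWithinAt (fun s => u r s) (g r) (Ici 0) 0

/-- The integrand in `λ` of the lower bound in dimension `2m`:
`{-2 C_{2,m} f(λ)/λ - 2|f'(λ)| + g(λ)} λ^m / (√(λ² - (r-ρ)²) √((r+ρ)² - λ²))`. -/
def evenIntegrand (m : ℕ) (ζ : ℝ) (f g : ℝ → ℝ) (r ρ l : ℝ) : ℝ :=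
  (-2 * C2 m ζ * (f l / l) - 2 * |deriv f l| + g l) *
    (l ^ m / (√(l ^ 2 - (r - ρ) ^ 2) * √((r + ρ) ^ 2 - l ^ 2)))

/-- The integrand in `ρ` of the lower bound in dimension `2m`. -/
def evenOuter (m : ℕ) (ζ : ℝ) (f g : ℝ → ℝ) (r t ρ : ℝ) : ℝ :=
  ρ / √(t ^ 2 - ρ ^ 2) * ∫ l in (r - ρ)..(r + ρ), evenIntegrand m ζ f g r ρ l

end RadialWave

end

/-!
Let `n - 1 = 2α` and `v = λ^α u`. The radial wave equation becomes
`v_ss - v_λλ + α(α-1) λ⁻² v = 0`, and if `K` solves Legendre's equation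
`(1 - z²) K'' - 2z K' + α(α-1) K = 0` with `K(1) = 1`, then `V = K(z)`, with
`z = (λ² + r² - (t-s)²) / (2rλ)`, solves the same equation and equals `1` on the characteristics
through `(r, t)`. Integrating the closed form `(V v_s - V_s v) dλ + (V v_λ - V_λ v) ds` over the
characteristic triangle below `(r, t)`, which stays away from the axis `λ = 0`, yields Riemann's
formula (`riemann_representation`)

`2 r^α u(r,t) = (r+t)^α f(r+t) + (r-t)^α f(r-t) + ∫ λ^α (K(z) g - K'(z) t/(rλ) f) dλ`

over `r - t ≤ λ ≤ r + t`, with `z` taken at `s = 0`. No information at the axis is needed, and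
in the region `Σ_1` the variable `z` stays in the interval where the admissible constants give
control (`invariant_mem_Icc`).

For `n = 2m + 1` the function `K` is the Legendre polynomial `P_{m-1}`, and the bounds
`P_{m-1} ≥ 1/2`, `P_{m-1}' ≤ m(m-1)/2` and `t ≤ r` give the estimate (`odd_lower_bound`).

For `n = 2m` it is the Legendre function `P_{m-3/2}`, for which the Mehler–Dirichlet integral
`K(z) = (2√2/π) ∫_0^{π/2} T_{m-1}(w) / √(1+w) dφ`, `w = z + (1-z) sin² φ`, serves as definition
(`mehler`, `isRiemannFunction_mehler`). Let `K₀` be the same integral with `1` in place of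
`T_{m-1}`. The admissibility of `ζ` implies `K ≥ K₀/2` and `K' ≤ (m-1)² K₀` (`mehler_bounds`), and
`t/r ≤ ζ/2`. Hence the `f`-term is at least `-C_{2,m} K₀ f/λ`, and the integrand is bounded below by
`K₀` times half of `-2 C_{2,m} f/λ - 2|f'| + g`. On the other side, interchanging the integrations
in the double integral over `ρ` and `λ` and substituting `ρ² = t² cos² φ + (λ-r)² sin² φ` produces
exactly the weight `K₀` (`integral_sphere_swap`), so the two sides compare pointwise in `λ`.
-/

noncomputable section

/-! ### Legendre and Chebyshev polynomials near `1` -/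

namespace RadialWave

open Polynomial in
/-- The `k`-th derivative of `w = (X² - 1)^k` solves Legendre's equation: differentiate
`(X² - 1) w' = 2k X w` another `k + 1` times. -/
theorem iterate_derivative_X_sq_sub_one_pow_ode (k : ℕ) (z : ℝ) :
    (1 - z ^ 2) * (derivative^[k + 2] ((X ^ 2 - 1 : ℝ[X]) ^ k)).eval z
      - 2 * z * (derivative^[k + 1] ((X ^ 2 - 1 : ℝ[X]) ^ k)).eval z
      + (k : ℝ) * (k + 1) * (derivative^[k] ((X ^ 2 - 1 : ℝ[X]) ^ k)).eval z = 0 := by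
  set w : ℝ[X] := (X ^ 2 - 1) ^ k with hw
  have h1 : (X ^ 2 - 1) * derivative w = 2 * (k : ℝ[X]) * X * w := by
    rcases k with _ | k
    · simp [hw]
    · rw [hw, derivative_pow_succ]
      simp only [derivative_sub, derivative_X_pow, derivative_one, map_natCast, map_add, map_one]
      push_cast
      ring
  have h2 : derivative^[2] w * X ^ 2 - derivative^[2] w
      = ((2 * k : ℕ) : ℝ[X]) * w + ((2 * (k : ℤ) - 2 : ℤ) : ℝ[X]) * (derivative w * X) := by
    have h := congr_arg derivative h1
    simp only [derivative_mul, derivative_sub, derivative_X_pow, derivative_one, derivative_X,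
      derivative_natCast, derivative_ofNat, map_natCast] at h
    simp only [Function.iterate_succ, Function.iterate_zero, Function.comp_apply, id]
    push_cast at h ⊢
    linear_combination h
  have h3 := congr_arg (fun p : ℝ[X] => (derivative^[k] p).eval z) h2
  simp only [iterate_derivative_sub, iterate_map_add, iterate_derivative_natCast_mul,
    iterate_derivative_intCast_mul] at h3
  rw [iterate_derivative_derivative_mul_X_sq, iterate_derivative_derivative_mul_X,
    ← Function.iterate_add_apply] at h3
  simp only [eval_sub, eval_add, eval_mul, eval_natCast, eval_intCast, eval_pow, eval_X,
    nsmul_eq_mul] at h3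
  rcases k with _ | k
  · push_cast at h3 ⊢
    linarith
  · rw [Nat.add_sub_cancel] at h3
    push_cast at h3 ⊢
    linear_combination -h3

open Polynomial in
theorem legendre_ode (k : ℕ) (z : ℝ) :
    (1 - z ^ 2) * (legendre k).derivative.derivative.eval z
      - 2 * z * (legendre k).derivative.eval z
      + (k : ℝ) * (k + 1) * (legendre k).eval z = 0 := by
  have h := iterate_derivative_X_sq_sub_one_pow_ode k z
  rw [Function.iterate_succ_apply', Function.iterate_succ_apply'] at h
  rw [legendre, derivative_C_mul, derivative_C_mul, eval_C_mul, eval_C_mul, eval_C_mul]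
  linear_combination (1 / (2 ^ k * (k.factorial : ℝ))) * h

open Polynomial in
theorem legendre_eval_one (k : ℕ) : (legendre k).eval 1 = 1 := by
  have h := aeval_iterate_derivative_self ((X ^ 2 - 1 : ℝ[X]) ^ k) k (1 : ℝ)
    (p' := (X + 1) ^ k) (by rw [Algebra.algebraMap_self, map_id, ← mul_pow]; congr 1; simp; ring)
  rw [coe_aeval_eq_eval] at h
  rw [legendre, eval_C_mul, h]
  have : (k.factorial : ℝ) ≠ 0 := by positivity
  simp only [eval_pow, eval_add, eval_X, eval_one, nsmul_eq_mul]
  norm_num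
  field_simp

theorem legendre_derivative_eval_one (k : ℕ) :
    (legendre k).derivative.eval 1 = (k : ℝ) * (k + 1) / 2 := by
  have h := legendre_ode k 1
  rw [legendre_eval_one] at h
  linarith

open Polynomial in
/-- Obtained by differentiating Legendre's equation once and evaluating at `1`. -/
theorem legendre_derivative_derivative_eval_one (k : ℕ) :
    (legendre k).derivative.derivative.eval 1
      = ((k : ℝ) * (k + 1) - 2) / 4 * ((k : ℝ) * (k + 1) / 2) := by
  have h : (1 - X ^ 2) * (legendre k).derivative.derivative
      - C 2 * X * (legendre k).derivative + C ((k : ℝ) * (k + 1)) * legendre k = 0 := by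
    refine Polynomial.funext fun z => ?_
    simp only [eval_add, eval_sub, eval_mul, eval_one, eval_pow, eval_X, eval_C, eval_zero]
    exact legendre_ode k z
  have h' := congr_arg (fun p => (derivative p).eval 1) h
  simp [-map_mul, -map_add, -map_natCast, legendre_derivative_eval_one] at h'
  linarith

open Polynomial in
/-- A polynomial with `p 1 = 1` and `p' 1 = c > 0` satisfies the admissibility bounds close to the
left of `1`, provided `p'` is either strictly increasing at `1` or constant. -/
theorem exists_bounds_near_one (p : ℝ[X]) {c : ℝ} (hc : 0 < c) (h1 : p.eval 1 = 1)
    (h2 : p.derivative.eval 1 = c)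
    (h3 : 0 < p.derivative.derivative.eval 1 ∨ p.derivative = C c) :
    ∃ η : ℝ, 0 < η ∧ ∀ z ∈ Icc (1 / (1 + η)) 1, 1 / 2 ≤ p.eval z ∧ p.eval z ≤ 1 ∧
      0 < p.derivative.eval z ∧ p.derivative.eval z ≤ c := by
  have e1 : ∀ᶠ z in nhds (1 : ℝ), 1 / 2 < p.eval z :=
    p.continuous.continuousAt.eventually_const_lt (by simp only [h1]; norm_num)
  have e2 : ∀ᶠ z in nhds (1 : ℝ), 0 < p.derivative.eval z :=
    p.derivative.continuous.continuousAt.eventually_const_lt (by simpa only [h2] using hc)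
  have e3 : ∀ᶠ z in nhds (1 : ℝ), 0 ≤ p.derivative.derivative.eval z := by
    rcases h3 with h3 | h3
    · exact (p.derivative.derivative.continuous.continuousAt.eventually_const_lt h3).mono
        fun _ h => h.le
    · simp [h3]
  obtain ⟨ε, hε, hb⟩ := Metric.eventually_nhds_iff.1 (e1.and (e2.and e3))
  have hlt : 1 - ε < 1 / (1 + ε) := by
    rw [lt_div_iff₀ (by linarith)]; nlinarith
  have key : ∀ z ∈ Icc (1 / (1 + ε)) 1, 1 / 2 < p.eval z ∧ 0 < p.derivative.eval z ∧
      0 ≤ p.derivative.derivative.eval z := by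
    intro z hz
    refine hb ?_
    rw [Real.dist_eq, abs_lt]
    constructor <;> linarith [hz.1, hz.2]
  have mono : ∀ q : ℝ[X], (∀ z ∈ Icc (1 / (1 + ε)) 1, 0 ≤ q.derivative.eval z) →
      ∀ z ∈ Icc (1 / (1 + ε)) 1, q.eval z ≤ q.eval 1 := by
    intro q hq z hz
    have hm : MonotoneOn (fun x => q.eval x) (Icc (1 / (1 + ε)) 1) :=
      monotoneOn_of_deriv_nonneg (convex_Icc _ _) q.continuous.continuousOn
        q.differentiable.differentiableOn
        fun x hx => by rw [q.deriv]; exact hq x (interior_subset hx)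
    exact hm hz ⟨hz.1.trans hz.2, le_rfl⟩ hz.2
  refine ⟨ε, hε, fun z hz => ⟨(key z hz).1.le, ?_, (key z hz).2.1, ?_⟩⟩
  · simpa [h1] using mono p (fun x hx => (key x hx).2.1.le) z hz
  · simpa [h2] using mono p.derivative (fun x hx => (key x hx).2.2) z hz

theorem exists_legendreConst {m : ℕ} (hm : 2 ≤ m) : ∃ η, LegendreConst m η := by
  obtain ⟨k, rfl⟩ : ∃ k, m = k + 2 := ⟨m - 2, by omega⟩
  have hk : (0 : ℝ) ≤ k := k.cast_nonneg
  obtain ⟨η, hη, h⟩ := exists_bounds_near_one (legendre (k + 1))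
    (c := ((k + 1 : ℕ) : ℝ) * ((k + 1 : ℕ) + 1) / 2) (by positivity) (legendre_eval_one _)
    (legendre_derivative_eval_one _) (by
      -- `P_1' = 1` is constant, whereas `P_k''(1) > 0` for `k ≥ 2`
      rcases k with _ | k
      · right
        refine Polynomial.funext fun z => ?_
        simp [legendre]
        norm_num
      · left
        rw [legendre_derivative_derivative_eval_one]
        push_cast
        have : (0 : ℝ) ≤ k := k.cast_nonneg
        have : 0 < ((k : ℝ) + 1 + 1) * (k + 1 + 1 + 1) - 2 := by nlinarith
        positivity)
  refine ⟨η, hη, fun z hz => ⟨(h z hz).1, (h z hz).2.2.1, (h z hz).2.2.2.trans (le_of_eq ?_)⟩⟩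
  push_cast
  ring

open Polynomial in
theorem chebyshev_ode (n : ℤ) (z : ℝ) :
    (1 - z ^ 2) * (Chebyshev.T ℝ n).derivative.derivative.eval z
      - z * (Chebyshev.T ℝ n).derivative.eval z + (n : ℝ) ^ 2 * (Chebyshev.T ℝ n).eval z = 0 := by
  have h := Chebyshev.one_sub_X_sq_mul_iterate_derivative_T_eval (R := ℝ) n 0 z
  simp only [Function.iterate_succ, Function.iterate_zero, Function.comp_apply, id] at h
  push_cast at h
  linear_combination h

theorem exists_chebyshevConst {m : ℕ} (hm : 2 ≤ m) : ∃ ζ, ChebyshevConst m ζ := by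
  obtain ⟨k, rfl⟩ : ∃ k, m = k + 2 := ⟨m - 2, by omega⟩
  have hk : (0 : ℝ) ≤ k := k.cast_nonneg
  have hN : ((k + 2 : ℕ) : ℤ) - 1 = (k + 1 : ℕ) := by push_cast; ring
  obtain ⟨ζ, hζ, h⟩ := exists_bounds_near_one (Polynomial.Chebyshev.T ℝ ((k + 1 : ℕ) : ℤ))
    (c := ((k : ℝ) + 1) ^ 2) (by positivity) (by simp)
    (by rw [Polynomial.Chebyshev.derivative_T_eval_one]; push_cast; ring) (by
      rcases k with _ | k
      · right; simp
      · left
        have h1 := Polynomial.Chebyshev.iterate_derivative_T_eval_one_recurrence (R := ℝ)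
          ((k + 1 + 1 : ℕ) : ℤ) 1
        simp only [Function.iterate_succ, Function.iterate_zero, Function.comp_apply, id,
          Polynomial.Chebyshev.derivative_T_eval_one] at h1
        push_cast at h1 ⊢
        have : (0 : ℝ) ≤ k := k.cast_nonneg
        have : 0 < (((k : ℝ) + 1 + 1) ^ 2 - 1 ^ 2) * (k + 1 + 1) ^ 2 := by
          have : 0 < ((k : ℝ) + 1 + 1) ^ 2 - 1 ^ 2 := by nlinarith
          positivity
        linarith)
  refine ⟨ζ, hζ, fun z hz => ?_⟩
  rw [hN]
  refine ⟨(h z hz).1, (h z hz).2.1, (h z hz).2.2.1, (h z hz).2.2.2.trans (le_of_eq ?_)⟩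
  push_cast
  ring

/-! ### Integrals over a compact interval depending on a parameter -/

theorem continuousOn_integral_of_continuousOn {F : ℝ → ℝ → ℝ} {A : Set ℝ} {a b : ℝ} (hab : a ≤ b)
    (hA : IsCompact A) (hF : ContinuousOn (fun p : ℝ × ℝ => F p.1 p.2) (A ×ˢ Icc a b)) :
    ContinuousOn (fun s => ∫ x in a..b, F s x) A := by
  obtain ⟨M, hM⟩ := (hA.prod isCompact_Icc).exists_bound_of_continuousOn hF
  intro s hs
  refine intervalIntegral.continuousWithinAt_of_dominated_interval (bound := fun _ => M) ?_ ?_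
    intervalIntegrable_const ?_
  · filter_upwards [self_mem_nhdsWithin] with y hy
    rw [uIoc_of_le hab]
    exact ((hF.comp (f := fun x => (y, x)) (by fun_prop) fun x hx => ⟨hy, hx⟩).mono
      Ioc_subset_Icc_self).aestronglyMeasurable measurableSet_Ioc
  · filter_upwards [self_mem_nhdsWithin] with y hy
    refine Filter.Eventually.of_forall fun x hx => ?_
    rw [uIoc_of_le hab] at hx
    exact hM (y, x) ⟨hy, Ioc_subset_Icc_self hx⟩
  · refine Filter.Eventually.of_forall fun x hx => ?_
    rw [uIoc_of_le hab] at hx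
    exact (hF.comp (f := fun y => (y, x)) (s := A) (by fun_prop)
      fun y hy => ⟨hy, Ioc_subset_Icc_self hx⟩) s hs

theorem hasDerivAt_integral_of_continuousOn {F F' : ℝ → ℝ → ℝ} {I : Set ℝ} {a b s : ℝ}
    (hab : a ≤ b) (hI : IsOpen I) (hs : s ∈ I)
    (hF : ∀ y ∈ I, ContinuousOn (F y) (Icc a b))
    (hF' : ContinuousOn (fun p : ℝ × ℝ => F' p.1 p.2) (I ×ˢ Icc a b))
    (hd : ∀ y ∈ I, ∀ x ∈ Icc a b, HasDerivAt (fun y => F y x) (F' y x) y) :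
    HasDerivAt (fun y => ∫ x in a..b, F y x) (∫ x in a..b, F' s x) s := by
  obtain ⟨ε, hε, hb⟩ := Metric.nhds_basis_closedBall.mem_iff.1 (hI.mem_nhds hs)
  obtain ⟨M, hM⟩ := ((isCompact_closedBall s ε).prod (isCompact_Icc (a := a) (b := b))
    ).exists_bound_of_continuousOn (hF'.mono (prod_mono hb subset_rfl))
  refine (intervalIntegral.hasDerivAt_integral_of_dominated_loc_of_deriv_le
    (bound := fun _ => M) (Metric.closedBall_mem_nhds s hε) ?_ ?_ ?_ ?_
    intervalIntegrable_const ?_).2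
  · filter_upwards [hI.mem_nhds hs] with y hy
    rw [uIoc_of_le hab]
    exact ((hF y hy).mono Ioc_subset_Icc_self).aestronglyMeasurable measurableSet_Ioc
  · exact (by simpa [uIcc_of_le hab] using hF s hs : ContinuousOn _ (uIcc a b)).intervalIntegrable
  · rw [uIoc_of_le hab]
    exact ((hF'.comp (f := fun x => (s, x)) (by fun_prop) fun x hx => ⟨hs, hx⟩).mono
      Ioc_subset_Icc_self).aestronglyMeasurable measurableSet_Ioc
  · refine Filter.Eventually.of_forall fun x hx y hy => ?_
    rw [uIoc_of_le hab] at hx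
    exact hM (y, x) ⟨hy, Ioc_subset_Icc_self hx⟩
  · refine Filter.Eventually.of_forall fun x hx y hy => ?_
    rw [uIoc_of_le hab] at hx
    exact hd y (hb hy) x (Ioc_subset_Icc_self hx)

/-- The integral of a closed form `Φ dλ + Ψ ds` over the horizontal sections
`|λ - r| ≤ t - s` of a characteristic triangle, written on the fixed interval `[-1, 1]`, changes
only through the values of the form on the two characteristic sides. -/
theorem hasDerivAt_integral_section {Φ Ψ : ℝ × ℝ → ℝ} {r t s : ℝ} (htr : t < r)
    (hΦ : ContDiffOn ℝ 1 Φ (Ioi 0 ×ˢ Ioo 0 t)) (hΨ : ContDiffOn ℝ 1 Ψ (Ioi 0 ×ˢ Ioo 0 t))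
    (hcl : ∀ l > 0, ∀ y ∈ Ioo 0 t, ∃ d, HasDerivAt (fun y => Φ (l, y)) d y ∧
      HasDerivAt (fun x => Ψ (x, y)) d l) (hs : s ∈ Ioo 0 t) :
    HasDerivAt (fun s => (t - s) * ∫ x in (-1 : ℝ)..1, Φ (r + (t - s) * x, s))
      (Ψ (r + (t - s), s) - Φ (r + (t - s), s) - Ψ (r - (t - s), s) - Φ (r - (t - s), s)) s := by
  have hU : IsOpen (Ioi (0 : ℝ) ×ˢ Ioo 0 t) := isOpen_Ioi.prod isOpen_Ioo
  have hmem : ∀ y ∈ Ioo 0 t, ∀ x ∈ Icc (-1 : ℝ) 1,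
      (r + (t - y) * x, y) ∈ Ioi (0 : ℝ) ×ˢ Ioo 0 t := by
    intro y hy x hx
    refine ⟨?_, hy⟩
    have : -(t - y) ≤ (t - y) * x := by nlinarith [hy.1, hy.2, hx.1, hx.2]
    simp only [mem_Ioi]
    linarith [hy.1]
  have fd : ∀ {Θ : ℝ × ℝ → ℝ}, ContDiffOn ℝ 1 Θ (Ioi 0 ×ˢ Ioo 0 t) →
      ∀ q ∈ Ioi (0 : ℝ) ×ˢ Ioo 0 t, HasFDerivAt Θ (fderiv ℝ Θ q) q := fun h q hq =>
    ((h.contDiffAt (hU.mem_nhds hq)).differentiableAt (by simp)).hasFDerivAt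
  have hline : ∀ l > 0, ∀ y ∈ Ioo 0 t,
      fderiv ℝ Φ (l, y) (0, 1) = fderiv ℝ Ψ (l, y) (1, 0) := by
    intro l hl y hy
    obtain ⟨d, h1, h2⟩ := hcl l hl y hy
    have e1 := (fd hΦ (l, y) ⟨hl, hy⟩).comp_hasDerivAt y
      ((hasDerivAt_const y l).prodMk (hasDerivAt_id y))
    have e2 := (fd hΨ (l, y) ⟨hl, hy⟩).comp_hasDerivAt l
      ((hasDerivAt_id l).prodMk (hasDerivAt_const l y))
    exact (e1.unique h1).trans (e2.unique h2).symm
  have split : ∀ (L : ℝ × ℝ →L[ℝ] ℝ) (a b : ℝ), L (a, b) = a * L (1, 0) + b * L (0, 1) := by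
    intro L a b
    have : ((a, b) : ℝ × ℝ) = a • ((1, 0) : ℝ × ℝ) + b • ((0, 1) : ℝ × ℝ) := by simp
    rw [this, map_add, map_smul, map_smul, smul_eq_mul, smul_eq_mul]
  -- the `y`-derivative `F'` of the integrand `(t - y) Φ` is, the form being closed, also the
  -- `x`-derivative of `Ψ - x Φ`
  let F' : ℝ → ℝ → ℝ := fun y x => -1 * Φ (r + (t - y) * x, y)
    + (t - y) * fderiv ℝ Φ (r + (t - y) * x, y) (-x, 1)
  have hmapc : ContinuousOn (fun p : ℝ × ℝ => (r + (t - p.1) * p.2, p.1))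
      (Ioo 0 t ×ˢ Icc (-1) 1) := by fun_prop
  have hmaps : MapsTo (fun p : ℝ × ℝ => (r + (t - p.1) * p.2, p.1)) (Ioo 0 t ×ˢ Icc (-1) 1)
      (Ioi (0 : ℝ) ×ˢ Ioo 0 t) := fun p hp => hmem p.1 hp.1 p.2 hp.2
  have hF'c : ContinuousOn (fun p : ℝ × ℝ => F' p.1 p.2) (Ioo 0 t ×ˢ Icc (-1) 1) := by
    have c1 := hΦ.continuousOn.comp hmapc hmaps
    have c2 : ContinuousOn (fun p : ℝ × ℝ => fderiv ℝ Φ (r + (t - p.1) * p.2, p.1))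
        (Ioo 0 t ×ˢ Icc (-1) 1) :=
      (hΦ.continuousOn_fderiv_of_isOpen hU le_rfl).comp hmapc hmaps
    have c3 : ContinuousOn (fun p : ℝ × ℝ => ((-p.2, 1) : ℝ × ℝ)) (Ioo 0 t ×ˢ Icc (-1) 1) := by
      fun_prop
    exact (continuousOn_const.mul c1).add
      (ContinuousOn.mul (by fun_prop) (c2.clm_apply c3))
  have key := hasDerivAt_integral_of_continuousOn (F := fun y x => (t - y) * Φ (r + (t - y) * x, y))
    (F' := F') (a := -1) (b := 1) (by norm_num) isOpen_Ioo hs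
    (fun y hy => ContinuousOn.mul continuousOn_const
      (hΦ.continuousOn.comp (f := fun x => (r + (t - y) * x, y)) (by fun_prop)
        fun x hx => hmem y hy x hx)) hF'c ?_
  · have hint : ∫ x in (-1 : ℝ)..1, F' s x
        = (Ψ (r + (t - s), s) - Φ (r + (t - s), s))
          - (Ψ (r - (t - s), s) + Φ (r - (t - s), s)) := by
      have hd : ∀ x ∈ uIcc (-1 : ℝ) 1,
          HasDerivAt (fun x => Ψ (r + (t - s) * x, s) - x * Φ (r + (t - s) * x, s)) (F' s x) x := by
        intro x hx
        rw [uIcc_of_le (by norm_num)] at hx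
        have hq := hmem s hs x hx
        have hc : HasDerivAt (fun x : ℝ => (r + (t - s) * x, s)) ((t - s, 0) : ℝ × ℝ) x := by
          refine HasDerivAt.prodMk ?_ (hasDerivAt_const _ _)
          simpa using ((hasDerivAt_id x).const_mul (t - s)).const_add r
        have e1 := (fd hΨ _ hq).comp_hasDerivAt x hc
        have e2 := (fd hΦ _ hq).comp_hasDerivAt x hc
        refine (e1.sub ((hasDerivAt_id x).mul e2)).congr_deriv ?_
        simp only [F', id, Function.comp]
        rw [split _ (t - s) 0, split _ (t - s) 0, split _ (-x) 1, hline _ hq.1 _ hs]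
        ring
      rw [intervalIntegral.integral_eq_sub_of_hasDerivAt hd]
      · rw [mul_one, mul_neg_one, ← sub_eq_add_neg]
        ring
      · refine ContinuousOn.intervalIntegrable ?_
        rw [uIcc_of_le (by norm_num)]
        exact hF'c.comp (f := fun x => (s, x)) (by fun_prop) fun x hx => ⟨hs, hx⟩
    rw [hint] at key
    refine (key.congr_deriv (by ring)).congr_of_eventuallyEq
      (Filter.Eventually.of_forall fun y => ?_)
    simp only [intervalIntegral.integral_const_mul]
  · intro y hy x hx
    have hq := hmem y hy x hx
    have hc : HasDerivAt (fun y : ℝ => (r + (t - y) * x, y)) ((-x, 1) : ℝ × ℝ) y := by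
      refine HasDerivAt.prodMk ?_ (hasDerivAt_id _)
      simpa using (((hasDerivAt_id y).const_sub t).mul_const x).const_add r
    have e := HasFDerivAt.comp_hasDerivAt (f := fun y : ℝ => (r + (t - y) * x, y)) y
      (fd hΦ _ hq) hc
    exact ((hasDerivAt_id y).const_sub t).mul e

/-! ### Riemann's representation formula -/

/-- The invariant `z = (λ² + r² - (t - s)²) / (2rλ)` of the pair of points `p = (λ, s)`, `(r, t)`.
It equals `1` exactly on the characteristics `λ = r ± (t - s)` through `(r, t)`. -/
def invariant (r t : ℝ) (p : ℝ × ℝ) : ℝ := (p.1 ^ 2 + r ^ 2 - (t - p.2) ^ 2) / (2 * r * p.1)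

theorem neg_one_lt_invariant {r t : ℝ} {p : ℝ × ℝ} (htr : t < r) (hp : 0 < p.1) (h0 : 0 ≤ p.2)
    (ht : p.2 ≤ t) : -1 < invariant r t p := by
  have hr : 0 < r := by linarith
  rw [invariant, lt_div_iff₀ (by positivity)]
  nlinarith [mul_pos hp hr]

theorem invariant_right {r t s : ℝ} (hr : 0 < r) (h : 0 < r + (t - s)) :
    invariant r t (r + (t - s), s) = 1 := by
  rw [invariant, div_eq_one_iff_eq (by positivity)]
  ring

theorem invariant_left {r t s : ℝ} (hr : 0 < r) (h : 0 < r - (t - s)) :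
    invariant r t (r - (t - s), s) = 1 := by
  rw [invariant, div_eq_one_iff_eq (by positivity)]
  ring

theorem contDiffOn_invariant {r t : ℝ} (hr : 0 < r) {A : Set (ℝ × ℝ)} (hA : ∀ p ∈ A, 0 < p.1) :
    ContDiffOn ℝ 1 (invariant r t) A := by
  refine ContDiffOn.div (by fun_prop) (by fun_prop) fun p hp => ?_
  have := hA p hp
  positivity

theorem hasDerivAt_invariant_time (r t l s : ℝ) :
    HasDerivAt (fun s => invariant r t (l, s)) (2 * (t - s) / (2 * r * l)) s := by
  have h : HasDerivAt (fun s => l ^ 2 + r ^ 2 - (t - s) ^ 2) (2 * (t - s)) s := by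
    refine ((((hasDerivAt_id s).const_sub t).pow 2).const_sub (l ^ 2 + r ^ 2)).congr_deriv ?_
    simp
  exact h.div_const (2 * r * l)

theorem hasDerivAt_invariant_space {r l : ℝ} (t s : ℝ) (hr : 0 < r) (hl : 0 < l) :
    HasDerivAt (fun l => invariant r t (l, s))
      ((l ^ 2 - r ^ 2 + (t - s) ^ 2) / (2 * r * l ^ 2)) l := by
  have h1 : HasDerivAt (fun l => l ^ 2 + r ^ 2 - (t - s) ^ 2) (2 * l) l := by
    simpa using (((hasDerivAt_id l).pow 2).add_const (r ^ 2)).sub_const ((t - s) ^ 2)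
  have h2 : HasDerivAt (fun l => 2 * r * l) (2 * r) l := by
    simpa using (hasDerivAt_id l).const_mul (2 * r)
  refine (h1.div h2 (by positivity)).congr_deriv ?_
  field_simp
  ring

/-- The derivative of `K(z)` with respect to the time `s`. -/
def kernelTime (K : ℝ → ℝ) (r t : ℝ) (p : ℝ × ℝ) : ℝ :=
  deriv K (invariant r t p) * (2 * (t - p.2) / (2 * r * p.1))

/-- The derivative of `K(z)` with respect to `λ`. -/
def kernelSpace (K : ℝ → ℝ) (r t : ℝ) (p : ℝ × ℝ) : ℝ :=
  deriv K (invariant r t p) * ((p.1 ^ 2 - r ^ 2 + (t - p.2) ^ 2) / (2 * r * p.1 ^ 2))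

/-- A Riemann function in the invariant `z`: a `C²` solution `K` on `(-1, ∞)` of Legendre's equation
`(1 - z²) K'' - 2 z K' + α (α - 1) K = 0`, normalised by `K(1) = 1`. -/
structure IsRiemannFunction (α : ℝ) (K : ℝ → ℝ) : Prop where
  contDiffOn : ContDiffOn ℝ 2 K (Ioi (-1))
  eval_one : K 1 = 1
  ode : ∀ z > -1, (1 - z ^ 2) * deriv (deriv K) z - 2 * z * deriv K z + α * (α - 1) * K z = 0

namespace IsRiemannFunction

variable {α : ℝ} {K : ℝ → ℝ}

theorem hasDerivAt (hK : IsRiemannFunction α K) {z : ℝ} (hz : -1 < z) :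
    HasDerivAt K (deriv K z) z :=
  ((hK.contDiffOn.contDiffAt (isOpen_Ioi.mem_nhds hz)).differentiableAt (by simp)).hasDerivAt

theorem contDiffOn_deriv (hK : IsRiemannFunction α K) : ContDiffOn ℝ 1 (deriv K) (Ioi (-1)) :=
  hK.contDiffOn.deriv_of_isOpen isOpen_Ioi (by norm_num)

theorem hasDerivAt_deriv (hK : IsRiemannFunction α K) {z : ℝ} (hz : -1 < z) :
    HasDerivAt (deriv K) (deriv (deriv K) z) z :=
  ((hK.contDiffOn_deriv.contDiffAt (isOpen_Ioi.mem_nhds hz)).differentiableAt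
    (by simp)).hasDerivAt

end IsRiemannFunction

/-- The classical solution, its time derivative and its space derivative, as functions on the
half space that are of class `C¹` up to `t = 0`. -/
theorem IsRadialFreeSolution.exists_derivatives {n : ℕ} {f g : ℝ → ℝ} {u : ℝ → ℝ → ℝ}
    (hu : IsRadialFreeSolution n f g u) :
    ∃ ut ur : ℝ × ℝ → ℝ, ContDiffOn ℝ 1 ut (Ioi 0 ×ˢ Ici 0) ∧ ContDiffOn ℝ 1 ur (Ioi 0 ×ˢ Ici 0) ∧
      (∀ l > 0, ut (l, 0) = g l) ∧
      (∀ l > 0, ∀ s > 0, HasFDerivAt (fun p : ℝ × ℝ => u p.1 p.2)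
        (ur (l, s) • ContinuousLinearMap.fst ℝ ℝ ℝ + ut (l, s) • ContinuousLinearMap.snd ℝ ℝ ℝ)
        (l, s)) ∧
      ∀ l > 0, ∀ s > 0, ∃ a b, HasDerivAt (fun s => ut (l, s)) a s ∧
        HasDerivAt (fun l => ur (l, s)) b l ∧ a - ((n : ℝ) - 1) / l * ur (l, s) - b = 0 := by
  set S : Set (ℝ × ℝ) := Ioi 0 ×ˢ Ici 0 with hS
  have hSu : UniqueDiffOn ℝ S := isOpen_Ioi.uniqueDiffOn.prod (uniqueDiffOn_Ici 0)
  set U : ℝ × ℝ → ℝ := fun p => u p.1 p.2 with hU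
  have hD : ContDiffOn ℝ 1 (fderivWithin ℝ U S) S := hu.contDiffOn.fderivWithin hSu (by norm_num)
  have hnhds : ∀ l > 0, ∀ s > 0, S ∈ nhds ((l, s) : ℝ × ℝ) := fun l hl s hs =>
    prod_mem_nhds (Ioi_mem_nhds hl) (Ici_mem_nhds hs)
  have split : ∀ (L : ℝ × ℝ →L[ℝ] ℝ),
      L = L (1, 0) • ContinuousLinearMap.fst ℝ ℝ ℝ + L (0, 1) • ContinuousLinearMap.snd ℝ ℝ ℝ := by
    intro L
    ext <;> simp
  have hfd : ∀ l > 0, ∀ s > 0, HasFDerivAt U (fderivWithin ℝ U S (l, s) (1, 0) •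
      ContinuousLinearMap.fst ℝ ℝ ℝ + fderivWithin ℝ U S (l, s) (0, 1) •
      ContinuousLinearMap.snd ℝ ℝ ℝ) (l, s) := by
    intro l hl s hs
    rw [← split]
    exact ((hu.contDiffOn.differentiableOn (by simp)) (l, s)
      ⟨hl, hs.le⟩).hasFDerivWithinAt.hasFDerivAt (hnhds l hl s hs)
  have hut : ∀ l > 0, ∀ s > 0,
      HasDerivAt (fun s => u l s) (fderivWithin ℝ U S (l, s) (0, 1)) s := by
    intro l hl s hs
    have := HasFDerivAt.comp_hasDerivAt (f := fun y : ℝ => (l, y)) s (hfd l hl s hs)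
      ((hasDerivAt_const s l).prodMk (hasDerivAt_id s))
    exact this.congr_deriv (by simp)
  have hur : ∀ l > 0, ∀ s > 0,
      HasDerivAt (fun l => u l s) (fderivWithin ℝ U S (l, s) (1, 0)) l := by
    intro l hl s hs
    have := HasFDerivAt.comp_hasDerivAt (f := fun y : ℝ => (y, s)) l (hfd l hl s hs)
      ((hasDerivAt_id l).prodMk (hasDerivAt_const l s))
    exact this.congr_deriv (by simp)
  have h01 : ContDiffOn ℝ 1 (fun p => fderivWithin ℝ U S p (0, 1)) S :=
    hD.clm_apply contDiffOn_const
  have h10 : ContDiffOn ℝ 1 (fun p => fderivWithin ℝ U S p (1, 0)) S :=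
    hD.clm_apply contDiffOn_const
  refine ⟨_, _, h01, h10, ?_, hfd, ?_⟩
  · intro l hl
    have h1 : HasFDerivWithinAt U (fderivWithin ℝ U S (l, 0)) S (l, 0) :=
      ((hu.contDiffOn.differentiableOn (by simp)) (l, 0) ⟨hl, mem_Ici.2 le_rfl⟩).hasFDerivWithinAt
    have h2 := HasFDerivWithinAt.comp_hasDerivWithinAt (f := fun y : ℝ => (l, y)) (s := Ici 0) 0 h1
      ((hasDerivWithinAt_const 0 _ l).prodMk (hasDerivWithinAt_id 0 _)) fun y hy => ⟨hl, hy⟩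
    exact (uniqueDiffWithinAt_Ici 0).eq_deriv _ h2 (hu.init_vel l hl)
  · intro l hl s hs
    have d1 : DifferentiableAt ℝ (fun s => fderivWithin ℝ U S (l, s) (0, 1)) s :=
      ((h01.contDiffAt (hnhds l hl s hs)).differentiableAt (by simp)).comp
        (f := fun y : ℝ => (l, y)) s (by fun_prop)
    have d2 : DifferentiableAt ℝ (fun l => fderivWithin ℝ U S (l, s) (1, 0)) l :=
      ((h10.contDiffAt (hnhds l hl s hs)).differentiableAt (by simp)).comp
        (f := fun y : ℝ => (y, s)) l (by fun_prop)
    have w := hu.wave l hl s hs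
    have e1 : deriv (fun s => u l s) =ᶠ[nhds s] fun s => fderivWithin ℝ U S (l, s) (0, 1) := by
      filter_upwards [Ioi_mem_nhds hs] with y hy using (hut l hl y hy).deriv
    have e2 : deriv (fun l => u l s) =ᶠ[nhds l] fun l => fderivWithin ℝ U S (l, s) (1, 0) := by
      filter_upwards [Ioi_mem_nhds hl] with y hy using (hur y hy s hs).deriv
    rw [e1.deriv_eq, e2.deriv_eq, (hur l hl s hs).deriv] at w
    exact ⟨_, _, d1.hasDerivAt, d2.hasDerivAt, w⟩

/-- The function `K(z)` solves the equation satisfied by `λ^α u`: this is Legendre's equation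
for `K`, rewritten in the variables `(λ, s)`. -/
theorem IsRiemannFunction.wave_equation {α : ℝ} {K : ℝ → ℝ} (hK : IsRiemannFunction α K)
    {r t l s : ℝ} (hr : 0 < r) (hl : 0 < l) (hz : -1 < invariant r t (l, s)) :
    ∃ ktt kll, HasDerivAt (fun s => kernelTime K r t (l, s)) ktt s ∧
      HasDerivAt (fun l => kernelSpace K r t (l, s)) kll l ∧
      ktt - kll + α * (α - 1) / l ^ 2 * K (invariant r t (l, s)) = 0 := by
  have d2 := hK.hasDerivAt_deriv hz
  have ht := HasDerivAt.comp s d2 (hasDerivAt_invariant_time r t l s)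
  have hx := HasDerivAt.comp (h := fun l => invariant r t (l, s)) l d2
    (hasDerivAt_invariant_space t s hr hl)
  have pt : HasDerivAt (fun s => 2 * (t - s) / (2 * r * l)) (2 * (-1) / (2 * r * l)) s :=
    ((((hasDerivAt_id s).const_sub t).const_mul 2).div_const _)
  have px : HasDerivAt (fun l => (l ^ 2 - r ^ 2 + (t - s) ^ 2) / (2 * r * l ^ 2))
      ((r ^ 2 - (t - s) ^ 2) / (r * l ^ 3)) l := by
    have h1 : HasDerivAt (fun l => l ^ 2 - r ^ 2 + (t - s) ^ 2) (2 * l) l := by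
      simpa using (((hasDerivAt_id l).pow 2).sub_const (r ^ 2)).add_const ((t - s) ^ 2)
    have h2 : HasDerivAt (fun l => 2 * r * l ^ 2) (2 * r * (2 * l)) l := by
      simpa using ((hasDerivAt_id l).pow 2).const_mul (2 * r)
    refine (h1.div h2 (by positivity)).congr_deriv ?_
    field_simp
    ring
  refine ⟨_, _, ht.mul pt, hx.mul px, ?_⟩
  have e := hK.ode _ hz
  simp only [Function.comp]
  generalize deriv (deriv K) (invariant r t (l, s)) = K2 at e ⊢
  generalize deriv K (invariant r t (l, s)) = K1 at e ⊢
  generalize K (invariant r t (l, s)) = K0 at e ⊢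
  rw [invariant] at e
  simp only at e
  have e' : ∀ x : ℝ, x = ((1 - ((l ^ 2 + r ^ 2 - (t - s) ^ 2) / (2 * r * l)) ^ 2) * K2
      - 2 * ((l ^ 2 + r ^ 2 - (t - s) ^ 2) / (2 * r * l)) * K1 + α * (α - 1) * K0) / l ^ 2 →
      x = 0 := by
    intro x hx
    rw [hx, e, zero_div]
  refine e' _ ?_
  field_simp
  ring

/-- Riemann's representation: integrating the closed form
`(V v_s - V_s v) dλ + (V v_λ - V_λ v) ds` with `v = λ^α u`, `V = K(z)` over the characteristic
triangle below `(r, t)`. On the two characteristics `V = 1`, so that they contribute `-dv`. -/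
theorem riemann_representation {n : ℕ} {f g : ℝ → ℝ} {u : ℝ → ℝ → ℝ} {α r t : ℝ} {K : ℝ → ℝ}
    (hu : IsRadialFreeSolution n f g u) (hK : IsRiemannFunction α K) (hn : (n : ℝ) - 1 = 2 * α)
    (ht : 0 < t) (htr : t < r) :
    2 * (r ^ α * u r t) = (r + t) ^ α * f (r + t) + (r - t) ^ α * f (r - t)
      + ∫ l in (r - t)..(r + t), l ^ α * (K (invariant r t (l, 0)) * g l
        - deriv K (invariant r t (l, 0)) * (t / (r * l)) * f l) := by
  have hr : 0 < r := ht.trans htr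
  obtain ⟨ut, ur, hut, hur, hg, hfd, hw⟩ := hu.exists_derivatives
  set U : ℝ × ℝ → ℝ := fun p => u p.1 p.2 with hU
  have hUc : ContDiffOn ℝ 2 U (Ioi 0 ×ˢ Ici 0) := hu.contDiffOn
  let Φ : ℝ × ℝ → ℝ := fun p =>
    p.1 ^ α * (K (invariant r t p) * ut p - kernelTime K r t p * U p)
  let Ψ : ℝ × ℝ → ℝ := fun p =>
    p.1 ^ α * (K (invariant r t p) * ur p - kernelSpace K r t p * U p)
      + α * p.1 ^ (α - 1) * (K (invariant r t p) * U p)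
  set A : Set (ℝ × ℝ) := Ioi 0 ×ˢ Icc 0 t with hA
  have hApos : ∀ p ∈ A, 0 < p.1 := fun p hp => hp.1
  have hAS : A ⊆ Ioi 0 ×ˢ Ici 0 := prod_mono subset_rfl Icc_subset_Ici_self
  have hUA : Ioi 0 ×ˢ Ioo 0 t ⊆ A := prod_mono subset_rfl Ioo_subset_Icc_self
  have hinv := contDiffOn_invariant (t := t) hr hApos
  have hmaps : MapsTo (invariant r t) A (Ioi (-1)) := fun p hp =>
    neg_one_lt_invariant htr hp.1 hp.2.1 hp.2.2
  have hKc : ContDiffOn ℝ 1 (fun p => K (invariant r t p)) A :=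
    (hK.contDiffOn.of_le (by norm_num)).comp hinv hmaps
  have hK'c : ContDiffOn ℝ 1 (fun p => deriv K (invariant r t p)) A :=
    hK.contDiffOn_deriv.comp hinv hmaps
  have hpow : ∀ β : ℝ, ContDiffOn ℝ 1 (fun p : ℝ × ℝ => p.1 ^ β) A := fun β =>
    contDiffOn_fst.rpow_const_of_ne fun p hp => (hApos p hp).ne'
  have hkt : ContDiffOn ℝ 1 (kernelTime K r t) A := by
    refine hK'c.mul (ContDiffOn.div (by fun_prop) (by fun_prop) fun p hp => ?_)
    have := hApos p hp
    positivity
  have hkl : ContDiffOn ℝ 1 (kernelSpace K r t) A := by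
    refine hK'c.mul (ContDiffOn.div (by fun_prop) (by fun_prop) fun p hp => ?_)
    have := hApos p hp
    positivity
  have hU1 : ContDiffOn ℝ 1 U A := (hUc.of_le (by norm_num)).mono hAS
  have hΦc : ContDiffOn ℝ 1 Φ A :=
    (hpow α).mul ((hKc.mul (hut.mono hAS)).sub (hkt.mul hU1))
  have hΨc : ContDiffOn ℝ 1 Ψ A :=
    ((hpow α).mul ((hKc.mul (hur.mono hAS)).sub (hkl.mul hU1))).add
      ((contDiffOn_const.mul (hpow (α - 1))).mul (hKc.mul hU1))
  have hUt : ∀ l > 0, ∀ s > 0, HasDerivAt (fun s => U (l, s)) (ut (l, s)) s := by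
    intro l hl s hs
    have := HasFDerivAt.comp_hasDerivAt (f := fun y : ℝ => (l, y)) s (hfd l hl s hs)
      ((hasDerivAt_const s l).prodMk (hasDerivAt_id s))
    exact this.congr_deriv (by simp)
  have hUl : ∀ l > 0, ∀ s > 0, HasDerivAt (fun l => U (l, s)) (ur (l, s)) l := by
    intro l hl s hs
    have := HasFDerivAt.comp_hasDerivAt (f := fun y : ℝ => (y, s)) l (hfd l hl s hs)
      ((hasDerivAt_id l).prodMk (hasDerivAt_const l s))
    exact this.congr_deriv (by simp)
  -- the form is closed
  have hcl : ∀ l > 0, ∀ y ∈ Ioo 0 t, ∃ d, HasDerivAt (fun y => Φ (l, y)) d y ∧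
      HasDerivAt (fun x => Ψ (x, y)) d l := by
    intro l hl y hy
    have hz : -1 < invariant r t (l, y) := neg_one_lt_invariant htr hl hy.1.le hy.2.le
    obtain ⟨a, b, ha, hb, hab⟩ := hw l hl y hy.1
    obtain ⟨ktt, kll, h1, h2, h12⟩ := hK.wave_equation hr hl hz
    have k1 : HasDerivAt (fun y => K (invariant r t (l, y))) (kernelTime K r t (l, y)) y :=
      HasDerivAt.comp y (hK.hasDerivAt hz) (hasDerivAt_invariant_time r t l y)
    have k2 : HasDerivAt (fun l => K (invariant r t (l, y))) (kernelSpace K r t (l, y)) l :=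
      HasDerivAt.comp (h := fun l => invariant r t (l, y)) l (hK.hasDerivAt hz)
        (hasDerivAt_invariant_space t y hr hl)
    have p1 := Real.hasDerivAt_rpow_const (x := l) (p := α) (Or.inl hl.ne')
    have p2 := Real.hasDerivAt_rpow_const (x := l) (p := α - 1) (Or.inl hl.ne')
    refine ⟨_, ((k1.mul ha).sub (h1.mul (hUt l hl y hy.1))).const_mul (l ^ α),
      ((p1.mul ((k2.mul hb).sub (h2.mul (hUl l hl y hy.1)))).add
        ((p2.const_mul α).mul (k2.mul (hUl l hl y hy.1)))).congr_deriv ?_⟩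
    simp only [Pi.mul_apply, Pi.sub_apply, Real.rpow_sub_one hl.ne']
    rw [hn] at hab
    generalize l ^ α = X
    generalize K (invariant r t (l, y)) = K0 at h12 ⊢
    have e1 : b = a - 2 * α / l * ur (l, y) := by linarith
    have e2 : kll = ktt + α * (α - 1) / l ^ 2 * K0 := by linarith
    rw [e1, e2]
    field_simp
    ring
  -- the integral over a horizontal section, with the values of `v` at its two ends, is conserved
  let J : ℝ → ℝ := fun s => (t - s) * (∫ x in (-1 : ℝ)..1, Φ (r + (t - s) * x, s))
    + ((r + (t - s)) ^ α * U (r + (t - s), s) + (r - (t - s)) ^ α * U (r - (t - s), s))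
  have hJc : ContinuousOn J (Icc 0 t) := by
    have hpos1 : ∀ s ∈ Icc 0 t, 0 < r + (t - s) := fun s hs => by linarith [hs.2]
    have hpos2 : ∀ s ∈ Icc 0 t, 0 < r - (t - s) := fun s hs => by linarith [hs.1]
    refine ContinuousOn.add (ContinuousOn.mul (by fun_prop)
      (continuousOn_integral_of_continuousOn (by norm_num) isCompact_Icc ?_)) (ContinuousOn.add
        (ContinuousOn.mul ?_ ?_) (ContinuousOn.mul ?_ ?_))
    · refine hΦc.continuousOn.comp (f := fun p : ℝ × ℝ => (r + (t - p.1) * p.2, p.1))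
        (by fun_prop) fun p hp => ⟨?_, hp.1⟩
      have h1 := hp.1
      have h2 := hp.2
      simp only [mem_Ioi]
      nlinarith [h1.1, h1.2, h2.1, h2.2]
    · exact ContinuousOn.rpow_const (by fun_prop) fun s hs => Or.inl (hpos1 s hs).ne'
    · exact hU1.continuousOn.comp (f := fun s : ℝ => (r + (t - s), s)) (by fun_prop)
        fun s hs => ⟨hpos1 s hs, hs⟩
    · exact ContinuousOn.rpow_const (by fun_prop) fun s hs => Or.inl (hpos2 s hs).ne'
    · exact hU1.continuousOn.comp (f := fun s : ℝ => (r - (t - s), s)) (by fun_prop)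
        fun s hs => ⟨hpos2 s hs, hs⟩
  have hJd : ∀ s ∈ Ioo 0 t, HasDerivAt J 0 s := by
    intro s hs
    have hp1 : 0 < r + (t - s) := by linarith [hs.2]
    have hp2 : 0 < r - (t - s) := by linarith [hs.1]
    have d0 := hasDerivAt_integral_section htr (hΦc.mono hUA) (hΨc.mono hUA) hcl hs
    have c1 : HasDerivAt (fun s : ℝ => r + (t - s)) (-1) s := by
      simpa using ((hasDerivAt_id s).const_sub t).const_add r
    have c2 : HasDerivAt (fun s : ℝ => r - (t - s)) 1 s := by
      simpa using ((hasDerivAt_id s).const_sub t).const_sub r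
    have u1 := HasFDerivAt.comp_hasDerivAt (f := fun s : ℝ => (r + (t - s), s)) s
      (hfd _ hp1 s hs.1) (c1.prodMk (hasDerivAt_id s))
    have u2 := HasFDerivAt.comp_hasDerivAt (f := fun s : ℝ => (r - (t - s), s)) s
      (hfd _ hp2 s hs.1) (c2.prodMk (hasDerivAt_id s))
    have w1 := (c1.rpow_const (p := α) (Or.inl hp1.ne')).mul u1
    have w2 := (c2.rpow_const (p := α) (Or.inl hp2.ne')).mul u2
    refine (d0.add (w1.add w2)).congr_deriv ?_
    simp only [Φ, Ψ, kernelTime, kernelSpace, invariant_right hr hp1, invariant_left hr hp2,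
      hK.eval_one, Function.comp, hU, add_apply, smul_apply,
      ContinuousLinearMap.coe_fst', ContinuousLinearMap.coe_snd', smul_eq_mul]
    have q1 : (r + (t - s)) ^ 2 - r ^ 2 + (t - s) ^ 2 = 2 * (t - s) * (r + (t - s)) := by ring
    have q2 : (r - (t - s)) ^ 2 - r ^ 2 + (t - s) ^ 2 = -(2 * (t - s) * (r - (t - s))) := by ring
    rw [q1, q2]
    field_simp
    ring
  obtain ⟨c, hc, hslope⟩ := exists_hasDerivAt_eq_slope J (fun _ => 0) ht hJc hJd
  have hJ : J t = J 0 := by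
    have : t - 0 ≠ 0 := by simpa using ht.ne'
    field_simp at hslope
    linarith
  have hJ0 : t * (∫ x in (-1 : ℝ)..1, Φ (r + t * x, 0)) = ∫ l in (r - t)..(r + t), Φ (l, 0) := by
    have := intervalIntegral.mul_integral_comp_mul_add (f := fun l => Φ (l, 0)) t r (a := -1)
      (b := 1)
    simp only [mul_neg_one, mul_one] at this
    rw [show r - t = -t + r by ring, show r + t = t + r by ring, ← this]
    simp only [add_comm]
  simp only [J, sub_self, zero_mul, zero_add, add_zero, sub_zero, hJ0, hU] at hJ
  have hi : ∀ l > 0, u l 0 = f l := fun l hl => hu.init_pos l hl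
  rw [hi _ (by linarith), hi _ (by linarith)] at hJ
  have hcongr : ∫ l in (r - t)..(r + t), Φ (l, 0) = ∫ l in (r - t)..(r + t), l ^ α *
      (K (invariant r t (l, 0)) * g l
        - deriv K (invariant r t (l, 0)) * (t / (r * l)) * f l) := by
    refine intervalIntegral.integral_congr fun l hl => ?_
    rw [uIcc_of_le (by linarith)] at hl
    have hl0 : 0 < l := by linarith [hl.1]
    simp only [Φ, kernelTime, hg l hl0, hU, hi l hl0, sub_zero]
    field_simp
  rw [← hcongr]
  linarith

/-! ### The region `Σ_1` -/

theorem invariant_mem_Icc {r t l η : ℝ} (hη : 0 < η) (ht : 0 < t) (hrt : 0 < r - t)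
    (h : 2 / η * t ≤ r - t) (hl : l ∈ Icc (r - t) (r + t)) :
    invariant r t (l, 0) ∈ Icc (1 / (1 + η)) 1 := by
  have hr : 0 < r := by linarith
  have hl0 : 0 < l := by linarith [hl.1]
  have h' : 2 * t ≤ η * (r - t) := by
    rw [div_mul_eq_mul_div, div_le_iff₀ hη] at h
    linarith
  have h1 : (r - t) / r ≤ invariant r t (l, 0) := by
    rw [invariant, div_le_div_iff₀ hr (by positivity)]
    have : 0 ≤ r * ((l - (r - t)) ^ 2 + (r - t) * (2 * t)) := by positivity
    simp only [sub_zero]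
    linarith
  refine ⟨le_trans ?_ h1, ?_⟩
  · rw [div_le_div_iff₀ (by positivity) hr]
    nlinarith
  · rw [invariant, div_le_one (by positivity)]
    simp only [sub_zero]
    nlinarith [hl.1, hl.2]

theorem sigma1_bounds {R η ζ r t : ℝ} (hR : 0 < R) (h : (r, t) ∈ Sigma1 R (delta η ζ)) :
    0 < t ∧ t < r ∧ R ≤ r - t ∧ 2 / η * t ≤ r - t ∧ 2 / ζ * t ≤ r - t := by
  obtain ⟨-, ht, hm⟩ := h
  simp only at ht hm
  have h1 := (le_max_left R (delta η ζ * t)).trans hm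
  have h2 := (le_max_right R (delta η ζ * t)).trans hm
  refine ⟨ht, by linarith, h1, le_trans ?_ h2, le_trans ?_ h2⟩
  · exact mul_le_mul_of_nonneg_right (le_max_left _ _) ht.le
  · exact mul_le_mul_of_nonneg_right (le_max_right _ _) ht.le

theorem IsRiemannFunction.continuousOn_comp_invariant {α r t : ℝ} {K : ℝ → ℝ}
    (hK : IsRiemannFunction α K) (ht : 0 < t) (htr : t < r) :
    ContinuousOn (fun l => K (invariant r t (l, 0))) (Icc (r - t) (r + t)) ∧
      ContinuousOn (fun l => deriv K (invariant r t (l, 0))) (Icc (r - t) (r + t)) := by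
  have hpos : ∀ l ∈ Icc (r - t) (r + t), 0 < l := fun l hl => by linarith [hl.1]
  have hc : ContinuousOn (fun l => invariant r t (l, 0)) (Icc (r - t) (r + t)) :=
    fun l hl => (hasDerivAt_invariant_space t 0 (ht.trans htr)
      (hpos l hl)).continuousAt.continuousWithinAt
  have hm : MapsTo (fun l => invariant r t (l, 0)) (Icc (r - t) (r + t)) (Ioi (-1)) :=
    fun l hl => neg_one_lt_invariant htr (hpos l hl) le_rfl ht.le
  exact ⟨hK.contDiffOn.continuousOn.comp hc hm, hK.contDiffOn_deriv.continuousOn.comp hc hm⟩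

/-- Riemann's representation with the integrand replaced by a smaller one. -/
theorem representation_lower_bound {n : ℕ} {f g : ℝ → ℝ} {u : ℝ → ℝ → ℝ} {α r t : ℝ} {K : ℝ → ℝ}
    (hu : IsRadialFreeSolution n f g u) (hK : IsRiemannFunction α K) (hn : (n : ℝ) - 1 = 2 * α)
    (ht : 0 < t) (htr : t < r) (hf : ContinuousOn f (Ioi 0)) (hg : ContinuousOn g (Ioi 0))
    {H : ℝ → ℝ} (hH : ContinuousOn H (Icc (r - t) (r + t)))
    (hle : ∀ l ∈ Icc (r - t) (r + t), H l ≤ K (invariant r t (l, 0)) * g l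
      - deriv K (invariant r t (l, 0)) * (t / (r * l)) * f l) :
    (r + t) ^ α * f (r + t) + (r - t) ^ α * f (r - t)
      + ∫ l in (r - t)..(r + t), l ^ α * H l ≤ 2 * (r ^ α * u r t) := by
  have hr := ht.trans htr
  have hpos : ∀ l ∈ Icc (r - t) (r + t), 0 < l := fun l hl => by linarith [hl.1]
  have hsub : Icc (r - t) (r + t) ⊆ Ioi 0 := hpos
  have hle' : r - t ≤ r + t := by linarith
  have hpow : ContinuousOn (fun l : ℝ => l ^ α) (Icc (r - t) (r + t)) :=
    continuousOn_id.rpow_const fun l hl => Or.inl (hpos l hl).ne'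
  obtain ⟨k1, k2⟩ := hK.continuousOn_comp_invariant ht htr
  have hq : ContinuousOn (fun l => t / (r * l)) (Icc (r - t) (r + t)) := by
    refine ContinuousOn.div (by fun_prop) (by fun_prop) fun l hl => ?_
    have := hpos l hl
    positivity
  rw [riemann_representation hu hK hn ht htr]
  refine add_le_add_right (intervalIntegral.integral_mono_on hle' ?_ ?_ fun l hl =>
    mul_le_mul_of_nonneg_left (hle l hl) (Real.rpow_nonneg (hpos l hl).le _)) _
  · refine ContinuousOn.intervalIntegrable ?_
    rw [uIcc_of_le hle']
    exact hpow.mul hH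
  · refine ContinuousOn.intervalIntegrable ?_
    rw [uIcc_of_le hle']
    exact hpow.mul ((k1.mul (hg.mono hsub)).sub ((k2.mul hq).mul (hf.mono hsub)))

/-! ### Odd space dimensions -/

theorem isRiemannFunction_legendre {m : ℕ} (hm : 1 ≤ m) :
    IsRiemannFunction m fun z => (legendre (m - 1)).eval z where
  contDiffOn := by
    have h := (legendre (m - 1)).contDiff_aeval (𝕜 := ℝ) 2
    simp only [Polynomial.coe_aeval_eq_eval] at h
    exact h.contDiffOn
  eval_one := legendre_eval_one _
  ode z _ := by
    have h := legendre_ode (m - 1) z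
    rw [Nat.cast_sub hm, Nat.cast_one] at h
    have e : deriv (fun z => (legendre (m - 1)).eval z)
        = fun z => (legendre (m - 1)).derivative.eval z := funext fun z => Polynomial.deriv _
    rw [e, Polynomial.deriv]
    linarith

theorem odd_lower_bound {m : ℕ} (hm : 2 ≤ m) {η R r t : ℝ} (hη : LegendreConst m η) (hR : 0 < R)
    {f g : ℝ → ℝ} {u : ℝ → ℝ → ℝ} (hf : ContinuousOn f (Ioi 0)) (hg : ContinuousOn g (Ioi 0))
    (hu : IsRadialFreeSolution (2 * m + 1) f g u) (hf0 : ∀ l ≥ R, 0 ≤ f l) (hg0 : ∀ l ≥ R, 0 ≤ g l)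
    (ht : 0 < t) (hRr : R ≤ r - t) (hηr : 2 / η * t ≤ r - t) :
    1 / (2 * r ^ m) * (f (r + t) * (r + t) ^ m + f (r - t) * (r - t) ^ m)
        + 1 / (4 * r ^ m) * ∫ l in (r - t)..(r + t), l ^ m * (-C1 m * (f l / l) + g l)
      ≤ u r t := by
  have htr : t < r := by linarith
  have hr : 0 < r := ht.trans htr
  have hpos : ∀ l ∈ Icc (r - t) (r + t), 0 < l := fun l hl => by linarith [hl.1]
  have hsub : Icc (r - t) (r + t) ⊆ Ioi 0 := hpos
  have key := representation_lower_bound hu (isRiemannFunction_legendre (by omega : 1 ≤ m))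
    (by push_cast; ring) ht htr hf hg (H := fun l => 1 / 2 * (-C1 m * (f l / l) + g l)) (by
      refine continuousOn_const.mul ((continuousOn_const.mul ((hf.mono hsub).div continuousOn_id
        fun l hl => (hpos l hl).ne')).add (hg.mono hsub))) (by
      intro l hl
      have hl0 := hpos l hl
      have hlR : R ≤ l := hRr.trans hl.1
      obtain ⟨h1, h2, h3⟩ := hη.2 _ (invariant_mem_Icc hη.1 ht (by linarith) hηr hl)
      rw [Polynomial.deriv]
      have e1 := mul_le_mul_of_nonneg_right h1 (hg0 l hlR)
      have e2 : t / (r * l) ≤ 1 / l := by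
        rw [div_le_div_iff₀ (by positivity) hl0]
        nlinarith
      have e3 := mul_le_mul_of_nonneg_right
        (mul_le_mul h3 e2 (by positivity) (h2.le.trans h3)) (hf0 l hlR)
      have e4 : 1 / 2 * (m : ℝ) * ((m : ℝ) - 1) * (1 / l) * f l = 1 / 2 * (C1 m * (f l / l)) := by
        rw [C1]; ring
      linarith)
  simp only [Real.rpow_natCast] at key
  have e : ∫ l in (r - t)..(r + t), l ^ m * (1 / 2 * (-C1 m * (f l / l) + g l))
      = 1 / 2 * ∫ l in (r - t)..(r + t), l ^ m * (-C1 m * (f l / l) + g l) := by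
    rw [← intervalIntegral.integral_const_mul]
    congr 1
    ext l
    ring
  rw [e] at key
  have hrm : 0 < r ^ m := by positivity
  have : u r t = 1 / (2 * r ^ m) * (2 * (r ^ m * u r t)) := by field_simp
  rw [this]
  refine le_trans (le_of_eq ?_) (mul_le_mul_of_nonneg_left key (by positivity))
  field_simp
  ring

/-! ### The Riemann function in even space dimensions -/

/-- The point `w = z + (1 - z) sin² φ` between `z` (at `φ = 0`) and `1` (at `φ = π / 2`). -/
def midpoint (z φ : ℝ) : ℝ := z + (1 - z) * Real.sin φ ^ 2

theorem neg_one_lt_midpoint {z : ℝ} (hz : -1 < z) (φ : ℝ) : -1 < midpoint z φ := by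
  have h : midpoint z φ = z * Real.cos φ ^ 2 + Real.sin φ ^ 2 := by
    rw [midpoint, Real.cos_sq']; ring
  have := Real.sin_sq_add_cos_sq φ
  rw [h]
  by_cases hc : Real.cos φ = 0
  · rw [hc] at this ⊢; nlinarith
  · have : 0 < Real.cos φ ^ 2 := by positivity
    nlinarith [sq_nonneg (Real.sin φ)]

theorem midpoint_mem_Icc {a z : ℝ} (hz : z ∈ Icc a 1) (φ : ℝ) : midpoint z φ ∈ Icc a 1 := by
  have h1 := Real.sin_sq_le_one φ
  have h2 := sq_nonneg (Real.sin φ)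
  constructor
  · rw [midpoint]; nlinarith [hz.1, hz.2]
  · rw [midpoint]; nlinarith [hz.1, hz.2]

/-- The integral over `0 ≤ φ ≤ π / 2` of `q (midpoint z φ)` with the weight `c φ`: up to
normalisation, a weighted mean of `q` over `[z, 1]`. -/
def mean (c q : ℝ → ℝ) (z : ℝ) : ℝ := ∫ φ in (0 : ℝ)..(Real.pi / 2), c φ * q (midpoint z φ)

theorem continuousOn_mean_integrand {c q : ℝ → ℝ} (hc : Continuous c)
    (hq : ContinuousOn q (Ioi (-1))) :
    ContinuousOn (fun p : ℝ × ℝ => c p.2 * q (midpoint p.1 p.2)) (Ioi (-1) ×ˢ univ) := by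
  refine ContinuousOn.mul (by fun_prop) (hq.comp (by unfold midpoint; fun_prop) fun p hp => ?_)
  exact neg_one_lt_midpoint hp.1 p.2

theorem continuousOn_mean {c q : ℝ → ℝ} (hc : Continuous c) (hq : ContinuousOn q (Ioi (-1))) :
    ContinuousOn (mean c q) (Ioi (-1)) := by
  intro z hz
  obtain ⟨ε, hε, hb⟩ := Metric.nhds_basis_closedBall.mem_iff.1 (isOpen_Ioi.mem_nhds hz)
  exact ((continuousOn_integral_of_continuousOn (F := fun z φ => c φ * q (midpoint z φ))
    (by positivity) (isCompact_closedBall z ε) ((continuousOn_mean_integrand hc hq).mono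
      (prod_mono hb (subset_univ _)))).continuousAt
        (Metric.closedBall_mem_nhds z hε)).continuousWithinAt

theorem intervalIntegrable_mean {c q : ℝ → ℝ} (hc : Continuous c) (hq : ContinuousOn q (Ioi (-1)))
    {z : ℝ} (hz : -1 < z) :
    IntervalIntegrable (fun φ => c φ * q (midpoint z φ)) volume 0 (Real.pi / 2) :=
  (continuousOn_univ.1 ((continuousOn_mean_integrand hc hq).comp (f := fun φ => (z, φ)) (s := univ)
    (by fun_prop) fun φ _ => ⟨hz, trivial⟩)).intervalIntegrable _ _

theorem hasDerivAt_mean {c q q' : ℝ → ℝ} (hc : Continuous c)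
    (hd : ∀ w > -1, HasDerivAt q (q' w) w) (hq' : ContinuousOn q' (Ioi (-1))) {z : ℝ}
    (hz : -1 < z) :
    HasDerivAt (mean c q) (mean (fun φ => c φ * Real.cos φ ^ 2) q' z) z := by
  have hq : ContinuousOn q (Ioi (-1)) := fun w hw => (hd w hw).continuousAt.continuousWithinAt
  refine hasDerivAt_integral_of_continuousOn (I := Ioi (-1))
    (F := fun z φ => c φ * q (midpoint z φ))
    (F' := fun z φ => c φ * Real.cos φ ^ 2 * q' (midpoint z φ)) (by positivity) isOpen_Ioi hz
    (fun y hy => ?_) ?_ fun y hy φ _ => ?_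
  · exact (continuousOn_mean_integrand hc hq).comp (f := fun φ => (y, φ)) (by fun_prop)
      fun φ _ => ⟨hy, trivial⟩
  · exact (continuousOn_mean_integrand (c := fun φ => c φ * Real.cos φ ^ 2) (by fun_prop) hq').mono
      (prod_mono subset_rfl (subset_univ _))
  · have h1 : HasDerivAt (fun z => midpoint z φ) (Real.cos φ ^ 2) y := by
      refine ((hasDerivAt_id y).add
        (((hasDerivAt_id y).const_sub 1).mul_const (Real.sin φ ^ 2))).congr_deriv ?_
      rw [Real.cos_sq']; ring
    refine ((HasDerivAt.comp (h := fun z => midpoint z φ) y (hd _ (neg_one_lt_midpoint hy φ))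
      h1).const_mul (c φ)).congr_deriv ?_
    ring

theorem contDiffOn_two_of_hasDerivAt {K K₁ K₂ : ℝ → ℝ} {I : Set ℝ} (hI : IsOpen I)
    (h1 : ∀ z ∈ I, HasDerivAt K (K₁ z) z) (h2 : ∀ z ∈ I, HasDerivAt K₁ (K₂ z) z)
    (hc : ContinuousOn K₂ I) : ContDiffOn ℝ 2 K I := by
  have c0 : ContDiffOn ℝ 1 K₁ I := by
    rw [show (1 : WithTop ℕ∞) = 0 + 1 by norm_num, contDiffOn_succ_iff_deriv_of_isOpen hI]
    refine ⟨fun z hz => (h2 z hz).differentiableAt.differentiableWithinAt, by simp, ?_⟩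
    exact contDiffOn_zero.2 (hc.congr fun z hz => (h2 z hz).deriv)
  rw [show (2 : WithTop ℕ∞) = 1 + 1 by norm_num, contDiffOn_succ_iff_deriv_of_isOpen hI]
  exact ⟨fun z hz => (h1 z hz).differentiableAt.differentiableWithinAt, by simp,
    c0.congr fun z hz => (h1 z hz).deriv⟩

/-- If `q` solves `(1 - w²) q'' + (1 - 2w) q' + μ q = 0`, then its mean solves Legendre's equation:
Legendre's operator applied to `q (z + (1 - z) sin² φ)` is the `φ`-derivative of
`-sin φ cos φ q'(w)`, which vanishes at both ends. -/
theorem mean_ode {q q₁ q₂ : ℝ → ℝ} {μ : ℝ} (h1 : ∀ w > -1, HasDerivAt q (q₁ w) w)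
    (h2 : ∀ w > -1, HasDerivAt q₁ (q₂ w) w) (hc : ContinuousOn q₂ (Ioi (-1)))
    (hode : ∀ w > -1, (1 - w ^ 2) * q₂ w + (1 - 2 * w) * q₁ w + μ * q w = 0) {z : ℝ}
    (hz : -1 < z) :
    (1 - z ^ 2) * mean (fun φ => 1 * Real.cos φ ^ 2 * Real.cos φ ^ 2) q₂ z
      - 2 * z * mean (fun φ => 1 * Real.cos φ ^ 2) q₁ z + μ * mean (fun _ => 1) q z = 0 := by
  have hq : ContinuousOn q (Ioi (-1)) := fun w hw => (h1 w hw).continuousAt.continuousWithinAt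
  have hq₁ : ContinuousOn q₁ (Ioi (-1)) := fun w hw => (h2 w hw).continuousAt.continuousWithinAt
  have i0 := intervalIntegrable_mean (c := fun _ => 1) continuous_const hq hz
  have i1 := intervalIntegrable_mean (c := fun φ => 1 * Real.cos φ ^ 2) (by fun_prop) hq₁ hz
  have i2 := intervalIntegrable_mean (c := fun φ => 1 * Real.cos φ ^ 2 * Real.cos φ ^ 2)
    (by fun_prop) hc hz
  simp only [mean]
  rw [← intervalIntegral.integral_const_mul, ← intervalIntegral.integral_const_mul,
    ← intervalIntegral.integral_const_mul, ← intervalIntegral.integral_sub (i2.const_mul _)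
      (i1.const_mul _), ← intervalIntegral.integral_add ((i2.const_mul _).sub (i1.const_mul _))
      (i0.const_mul _)]
  rw [intervalIntegral.integral_eq_sub_of_hasDerivAt
    (f := fun φ => -(Real.sin φ * Real.cos φ * q₁ (midpoint z φ)))]
  · simp
  · intro φ _
    have hw := neg_one_lt_midpoint hz φ
    have d1 : HasDerivAt (fun φ => midpoint z φ) ((1 - z) * (2 * Real.sin φ * Real.cos φ)) φ := by
      have := (((Real.hasDerivAt_sin φ).pow 2).const_mul (1 - z)).const_add z
      exact this.congr_deriv (by simp)
    have d2 := HasDerivAt.comp φ (h2 _ hw) d1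
    refine (((Real.hasDerivAt_sin φ).mul (Real.hasDerivAt_cos φ)).mul d2).neg.congr_deriv ?_
    have e := hode _ hw
    simp only [Function.comp, Pi.mul_apply]
    have e0 : μ * q (midpoint z φ) = -((1 - midpoint z φ ^ 2) * q₂ (midpoint z φ)
      + (1 - 2 * midpoint z φ) * q₁ (midpoint z φ)) := by linarith
    have e1 : Real.cos φ ^ 2 = 1 - Real.sin φ ^ 2 := Real.cos_sq' φ
    rw [one_mul, mul_left_comm μ, e0]
    generalize q₂ (midpoint z φ) = A
    generalize q₁ (midpoint z φ) = B
    rw [midpoint]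
    have e2 : Real.cos φ ^ 2 * Real.cos φ ^ 2 = (1 - Real.sin φ ^ 2) ^ 2 := by rw [e1]; ring
    rw [e2, e1]
    linear_combination (-B - 2 * (1 - z) * A * Real.sin φ ^ 2) * e1
  · exact ((i2.const_mul _).sub (i1.const_mul _)).add (i0.const_mul _)

/-- The factor `p(w) / √(1 + w)` in the Mehler–Dirichlet integral. -/
def mehlerFactor (p : Polynomial ℝ) (w : ℝ) : ℝ := p.eval w / √(1 + w)

/-- The first derivative of `mehlerFactor p`. -/
def mehlerFactor₁ (p : Polynomial ℝ) (w : ℝ) : ℝ :=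
  p.derivative.eval w / √(1 + w) - p.eval w / (2 * √(1 + w) ^ 3)

/-- The second derivative of `mehlerFactor p`. -/
def mehlerFactor₂ (p : Polynomial ℝ) (w : ℝ) : ℝ :=
  p.derivative.derivative.eval w / √(1 + w) - p.derivative.eval w / √(1 + w) ^ 3
    + 3 * p.eval w / (4 * √(1 + w) ^ 5)

theorem hasDerivAt_sqrt_one_add {w : ℝ} (hw : -1 < w) :
    HasDerivAt (fun w => √(1 + w)) (1 / (2 * √(1 + w))) w :=
  ((hasDerivAt_id w).const_add 1).sqrt (by simp only [id]; linarith)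

theorem hasDerivAt_mehlerFactor (p : Polynomial ℝ) {w : ℝ} (hw : -1 < w) :
    HasDerivAt (mehlerFactor p) (mehlerFactor₁ p w) w := by
  have hs : 0 < √(1 + w) := Real.sqrt_pos.2 (by linarith)
  refine ((p.hasDerivAt w).div (hasDerivAt_sqrt_one_add hw) hs.ne').congr_deriv ?_
  rw [mehlerFactor₁]
  field_simp

theorem hasDerivAt_mehlerFactor₁ (p : Polynomial ℝ) {w : ℝ} (hw : -1 < w) :
    HasDerivAt (mehlerFactor₁ p) (mehlerFactor₂ p w) w := by
  have hs : 0 < √(1 + w) := Real.sqrt_pos.2 (by linarith)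
  have h := hasDerivAt_sqrt_one_add hw
  refine ((p.derivative.hasDerivAt w).div h hs.ne').sub
    ((p.hasDerivAt w).div ((h.pow 3).const_mul 2)
      (mul_ne_zero two_ne_zero (pow_pos hs 3).ne')) |>.congr_deriv ?_
  rw [mehlerFactor₂]
  simp only [Pi.pow_apply]
  field_simp
  norm_num
  ring

theorem continuousOn_mehlerFactor₂ (p : Polynomial ℝ) :
    ContinuousOn (mehlerFactor₂ p) (Ioi (-1)) := by
  have hs : ∀ w ∈ Ioi (-1 : ℝ), 0 < √(1 + w) := fun w hw =>
    Real.sqrt_pos.2 (by linarith [mem_Ioi.1 hw])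
  have hc : Continuous fun w : ℝ => √(1 + w) := by fun_prop
  refine ((p.derivative.derivative.continuous.continuousOn.div hc.continuousOn
    fun w hw => (hs w hw).ne').sub (p.derivative.continuous.continuousOn.div
    (hc.pow 3).continuousOn fun w hw => (pow_pos (hs w hw) 3).ne')).add
    (ContinuousOn.div ?_ ?_ fun w hw => ?_)
  · exact (continuous_const.mul p.continuous).continuousOn
  · exact (continuous_const.mul (hc.pow 5)).continuousOn
  · have := hs w hw
    positivity

theorem mehlerFactor_ode (n : ℤ) {w : ℝ} (hw : -1 < w) :
    (1 - w ^ 2) * mehlerFactor₂ (Polynomial.Chebyshev.T ℝ n) w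
      + (1 - 2 * w) * mehlerFactor₁ (Polynomial.Chebyshev.T ℝ n) w
      + ((n : ℝ) ^ 2 - 1 / 4) * mehlerFactor (Polynomial.Chebyshev.T ℝ n) w = 0 := by
  have hs : 0 < √(1 + w) := Real.sqrt_pos.2 (by linarith)
  have e : √(1 + w) ^ 2 = 1 + w := Real.sq_sqrt (by linarith)
  have h := chebyshev_ode n w
  rw [mehlerFactor, mehlerFactor₁, mehlerFactor₂]
  have hw' : w = √(1 + w) ^ 2 - 1 := by linarith
  generalize (Polynomial.Chebyshev.T ℝ n).derivative.derivative.eval w = T2 at *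
  generalize (Polynomial.Chebyshev.T ℝ n).derivative.eval w = T1 at *
  generalize (Polynomial.Chebyshev.T ℝ n).eval w = T0 at *
  generalize √(1 + w) = s at *
  subst hw'
  field_simp
  linear_combination 8 * s ^ 4 * h

/-- The Mehler–Dirichlet integral `(2√2/π) ∫_0^{π/2} p(w) / √(1 + w) dφ`, `w = z + (1 - z) sin² φ`.
For `p = T_{m-1}` it is the Legendre function `P_{m-3/2}`. -/
def mehler (p : Polynomial ℝ) (z : ℝ) : ℝ :=
  2 * √2 / Real.pi * mean (fun _ => 1) (mehlerFactor p) z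

theorem hasDerivAt_mehler (p : Polynomial ℝ) {z : ℝ} (hz : -1 < z) :
    HasDerivAt (mehler p)
      (2 * √2 / Real.pi * mean (fun φ => 1 * Real.cos φ ^ 2) (mehlerFactor₁ p) z) z :=
  (hasDerivAt_mean continuous_const (fun _ hw => hasDerivAt_mehlerFactor p hw)
    (fun _ hw => (hasDerivAt_mehlerFactor₁ p hw).continuousAt.continuousWithinAt) hz).const_mul _

theorem isRiemannFunction_mehler (n : ℤ) :
    IsRiemannFunction (n + 1 / 2) (mehler (Polynomial.Chebyshev.T ℝ n)) := by
  set p := Polynomial.Chebyshev.T ℝ n with hp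
  have d1 : ∀ z ∈ Ioi (-1 : ℝ), HasDerivAt (mehler p) _ z := fun z hz => hasDerivAt_mehler p hz
  have d2 : ∀ z ∈ Ioi (-1 : ℝ), HasDerivAt
      (fun z => 2 * √2 / Real.pi * mean (fun φ => 1 * Real.cos φ ^ 2) (mehlerFactor₁ p) z)
      (2 * √2 / Real.pi * mean (fun φ => 1 * Real.cos φ ^ 2 * Real.cos φ ^ 2)
        (mehlerFactor₂ p) z) z := fun z hz =>
    (hasDerivAt_mean (by fun_prop) (fun _ hw => hasDerivAt_mehlerFactor₁ p hw)
      (continuousOn_mehlerFactor₂ p) hz).const_mul _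
  have c2 := (continuousOn_mean (c := fun φ => 1 * Real.cos φ ^ 2 * Real.cos φ ^ 2) (by fun_prop)
    (continuousOn_mehlerFactor₂ p)).const_smul (2 * √2 / Real.pi)
  refine ⟨contDiffOn_two_of_hasDerivAt isOpen_Ioi d1 d2 c2, ?_, fun z hz => ?_⟩
  · have hpi := Real.pi_pos
    have h2 : 0 < √(2 : ℝ) := by positivity
    simp only [mehler, mean, midpoint, mehlerFactor, hp]
    norm_num
    field_simp
  · have e : deriv (mehler p) =ᶠ[nhds z]
        fun z => 2 * √2 / Real.pi * mean (fun φ => 1 * Real.cos φ ^ 2) (mehlerFactor₁ p) z := by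
      filter_upwards [isOpen_Ioi.mem_nhds hz] with y hy using (d1 y hy).deriv
    rw [e.deriv_eq, e.eq_of_nhds, (d2 z hz).deriv, mehler]
    have h := mean_ode (μ := (n : ℝ) ^ 2 - 1 / 4) (fun _ hw => hasDerivAt_mehlerFactor p hw)
      (fun _ hw => hasDerivAt_mehlerFactor₁ p hw) (continuousOn_mehlerFactor₂ p)
      (fun _ hw => mehlerFactor_ode n hw) hz
    linear_combination 2 * √2 / Real.pi * h

theorem intervalIntegrable_mehlerFactor (p : Polynomial ℝ) {z : ℝ} (hz : -1 < z) :
    IntervalIntegrable (fun φ => 1 * mehlerFactor p (midpoint z φ)) volume 0 (Real.pi / 2) :=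
  intervalIntegrable_mean (c := fun _ => 1) continuous_const
    (fun _ hw => (hasDerivAt_mehlerFactor p hw).continuousAt.continuousWithinAt) hz

/-- If `p ≥ 1/2` and `p' ≤ b` on `[a, 1]`, then the Mehler integral of `p` is comparable there with
that of `1`. In the derivative, the term coming from `1 / √(1 + w)` has a favourable sign. -/
theorem mehler_bounds {p : Polynomial ℝ} {a b z : ℝ} (ha : -1 < a)
    (h : ∀ w ∈ Icc a 1, 1 / 2 ≤ p.eval w ∧ p.derivative.eval w ≤ b) (hb : 0 ≤ b)
    (hz : z ∈ Icc a 1) :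
    1 / 2 * mehler 1 z ≤ mehler p z ∧ deriv (mehler p) z ≤ b * mehler 1 z := by
  have hz' : -1 < z := ha.trans_le hz.1
  have hpi := Real.pi_pos
  have hle : (0 : ℝ) ≤ Real.pi / 2 := by positivity
  have hc : (0 : ℝ) ≤ 2 * √2 / Real.pi := by positivity
  have i1 := intervalIntegrable_mehlerFactor 1 hz'
  have hs : ∀ φ, 0 < √(1 + midpoint z φ) := fun φ =>
    Real.sqrt_pos.2 (by linarith [neg_one_lt_midpoint hz' φ])
  constructor
  · rw [mehler, mehler, mul_left_comm]
    refine mul_le_mul_of_nonneg_left ?_ hc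
    rw [mean, mean, ← intervalIntegral.integral_const_mul]
    refine intervalIntegral.integral_mono_on hle (i1.const_mul _)
      (intervalIntegrable_mehlerFactor p hz') fun φ _ => ?_
    have := (h _ (midpoint_mem_Icc hz φ)).1
    simp only [mehlerFactor, Polynomial.eval_one, one_mul]
    rw [← mul_div_assoc, mul_one]
    exact div_le_div_of_nonneg_right this (hs φ).le
  · rw [(hasDerivAt_mehler p hz').deriv, mehler, mul_left_comm b]
    refine mul_le_mul_of_nonneg_left ?_ hc
    rw [mean, mean, ← intervalIntegral.integral_const_mul]
    refine intervalIntegral.integral_mono_on hle (intervalIntegrable_mean (by fun_prop)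
      (fun _ hw => (hasDerivAt_mehlerFactor₁ p hw).continuousAt.continuousWithinAt) hz')
      (i1.const_mul _) fun φ _ => ?_
    obtain ⟨h1, h2⟩ := h _ (midpoint_mem_Icc hz φ)
    have hs' := hs φ
    simp only [mehlerFactor, mehlerFactor₁, Polynomial.eval_one, one_mul]
    have e1 : (Polynomial.derivative p).eval (midpoint z φ) / √(1 + midpoint z φ)
        - p.eval (midpoint z φ) / (2 * √(1 + midpoint z φ) ^ 3)
        ≤ b * (1 / √(1 + midpoint z φ)) := by
      have : 0 ≤ p.eval (midpoint z φ) / (2 * √(1 + midpoint z φ) ^ 3) :=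
        div_nonneg (by linarith) (by positivity)
      have := div_le_div_of_nonneg_right h2 hs'.le
      rw [mul_one_div]
      linarith
    refine (mul_le_mul_of_nonneg_left e1 (sq_nonneg _)).trans ?_
    exact mul_le_of_le_one_left (by positivity) (Real.cos_sq_le_one φ)

/-! ### The double integral over spheres -/

/-- The kernel `ρ / (√(t² - ρ²) √(λ² - (r - ρ)²) √((r + ρ)² - λ²))`. Since square roots of negative
numbers and quotients by zero are zero, for `0 < ρ ≤ t < r` and `λ ≥ 0` it vanishes unless
`|λ - r| < ρ < t`. -/
def sphereKernel (r t l ρ : ℝ) : ℝ :=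
  ρ / √(t ^ 2 - ρ ^ 2) * (1 / (√(l ^ 2 - (r - ρ) ^ 2) * √((r + ρ) ^ 2 - l ^ 2)))

theorem sphereKernel_nonneg {r t l ρ : ℝ} (hρ : 0 ≤ ρ) : 0 ≤ sphereKernel r t l ρ := by
  unfold sphereKernel
  positivity

theorem measurable_sphereKernel (r t : ℝ) :
    Measurable fun p : ℝ × ℝ => sphereKernel r t p.1 p.2 := by
  unfold sphereKernel
  fun_prop

theorem sqrt_mul_sqrt_eq_zero {r l ρ : ℝ} (hl : 0 ≤ l) (hρ : 0 ≤ ρ) (hρr : ρ ≤ r)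
    (h : ρ ≤ |l - r|) : √(l ^ 2 - (r - ρ) ^ 2) * √((r + ρ) ^ 2 - l ^ 2) = 0 := by
  rcases le_abs.1 h with h | h
  · rw [Real.sqrt_eq_zero_of_nonpos (x := (r + ρ) ^ 2 - l ^ 2) (by nlinarith), mul_zero]
  · rw [Real.sqrt_eq_zero_of_nonpos (x := l ^ 2 - (r - ρ) ^ 2) (by nlinarith), zero_mul]

theorem sphereKernel_eq_zero {r t l ρ : ℝ} (htr : t < r) (hl : 0 ≤ l) (hρ : ρ ∈ Ioc 0 t)
    (h : ρ ∉ Ioo |l - r| t) : sphereKernel r t l ρ = 0 := by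
  rw [sphereKernel]
  by_cases h1 : ρ ≤ |l - r|
  · rw [sqrt_mul_sqrt_eq_zero hl hρ.1.le (by linarith [hρ.2]) h1]
    simp
  · have h2 : ρ = t := le_antisymm hρ.2 (not_lt.1 fun h3 => h ⟨not_le.1 h1, h3⟩)
    simp [h2]

/-- The radius `ρ = √(t² cos² φ + a² sin² φ)`, running from `t` to `a`. -/
def radius (a t φ : ℝ) : ℝ := √(t ^ 2 - (t ^ 2 - a ^ 2) * Real.sin φ ^ 2)

theorem radius_sq_pos {a t φ : ℝ} (ha : 0 ≤ a) (hat : a < t) (hφ : φ ∈ Ioo 0 (Real.pi / 2)) :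
    a ^ 2 < t ^ 2 - (t ^ 2 - a ^ 2) * Real.sin φ ^ 2 ∧
      t ^ 2 - (t ^ 2 - a ^ 2) * Real.sin φ ^ 2 < t ^ 2 := by
  have hd : 0 < t ^ 2 - a ^ 2 := by nlinarith
  have hs : 0 < Real.sin φ := Real.sin_pos_of_pos_of_lt_pi hφ.1 (by linarith [hφ.2, Real.pi_pos])
  have hc : 0 < Real.cos φ := Real.cos_pos_of_mem_Ioo ⟨by linarith [hφ.1, Real.pi_pos], hφ.2⟩
  have := Real.sin_sq_add_cos_sq φ
  constructor
  · nlinarith [mul_pos hd (pow_pos hc 2)]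
  · nlinarith [mul_pos hd (pow_pos hs 2)]

theorem injOn_radius {a t : ℝ} (ha : 0 ≤ a) (hat : a < t) :
    InjOn (radius a t) (Ioo 0 (Real.pi / 2)) := by
  intro x hx y hy h
  have hd : 0 < t ^ 2 - a ^ 2 := by nlinarith
  have h1 := (radius_sq_pos ha hat hx).1
  have h2 := (radius_sq_pos ha hat hy).1
  rw [radius, radius, Real.sqrt_inj (by nlinarith) (by nlinarith)] at h
  have h3 : Real.sin x ^ 2 = Real.sin y ^ 2 := by
    have : (t ^ 2 - a ^ 2) * Real.sin x ^ 2 = (t ^ 2 - a ^ 2) * Real.sin y ^ 2 := by linarith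
    exact mul_left_cancel₀ hd.ne' this
  have hsin : ∀ z ∈ Ioo 0 (Real.pi / 2), 0 ≤ Real.sin z := fun z hz =>
    Real.sin_nonneg_of_nonneg_of_le_pi hz.1.le (by linarith [hz.2, Real.pi_pos])
  rw [sq_eq_sq₀ (hsin x hx) (hsin y hy)] at h3
  exact Real.injOn_sin ⟨by linarith [hx.1, Real.pi_pos], hx.2.le⟩
    ⟨by linarith [hy.1, Real.pi_pos], hy.2.le⟩ h3

theorem image_radius {a t : ℝ} (ha : 0 ≤ a) (hat : a < t) :
    radius a t '' Ioo 0 (Real.pi / 2) = Ioo a t := by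
  have ht : 0 < t := ha.trans_lt hat
  have hd : 0 < t ^ 2 - a ^ 2 := by nlinarith
  ext ρ
  constructor
  · rintro ⟨φ, hφ, rfl⟩
    obtain ⟨h1, h2⟩ := radius_sq_pos ha hat hφ
    exact ⟨Real.lt_sqrt_of_sq_lt h1, (Real.sqrt_lt' ht).2 h2⟩
  · rintro ⟨h1, h2⟩
    have hρ : 0 < ρ := ha.trans_lt h1
    have hx0 : 0 < (t ^ 2 - ρ ^ 2) / (t ^ 2 - a ^ 2) := div_pos (by nlinarith) hd
    have hx1 : (t ^ 2 - ρ ^ 2) / (t ^ 2 - a ^ 2) < 1 := by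
      rw [div_lt_one hd]; nlinarith
    have hy0 := Real.sqrt_pos.2 hx0
    have hy1 : √((t ^ 2 - ρ ^ 2) / (t ^ 2 - a ^ 2)) < 1 := by
      rw [Real.sqrt_lt' one_pos]; simpa using hx1
    refine ⟨Real.arcsin √((t ^ 2 - ρ ^ 2) / (t ^ 2 - a ^ 2)),
      ⟨Real.arcsin_pos.2 hy0, Real.arcsin_lt_pi_div_two.2 hy1⟩, ?_⟩
    rw [radius, Real.sin_arcsin (by linarith) hy1.le, Real.sq_sqrt hx0.le,
      mul_div_cancel₀ _ hd.ne', sub_sub_cancel, Real.sqrt_sq hρ.le]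

theorem hasDerivAt_radius {a t φ : ℝ} (ha : 0 ≤ a) (hat : a < t)
    (hφ : φ ∈ Ioo 0 (Real.pi / 2)) :
    HasDerivAt (radius a t)
      (-((t ^ 2 - a ^ 2) * (Real.sin φ * Real.cos φ)) / radius a t φ) φ := by
  have h1 := (radius_sq_pos ha hat hφ).1
  have h2 : HasDerivAt (fun φ => t ^ 2 - (t ^ 2 - a ^ 2) * Real.sin φ ^ 2)
      (-((t ^ 2 - a ^ 2) * (2 * Real.sin φ * Real.cos φ))) φ := by
    have := (((Real.hasDerivAt_sin φ).pow 2).const_mul (t ^ 2 - a ^ 2)).const_sub (t ^ 2)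
    exact this.congr_deriv (by simp)
  refine (h2.sqrt (by nlinarith)).congr_deriv ?_
  rw [radius]
  have : 0 < √(t ^ 2 - (t ^ 2 - a ^ 2) * Real.sin φ ^ 2) := Real.sqrt_pos.2 (by nlinarith)
  field_simp

/-- In the variable `φ` the kernel loses its singularities. -/
theorem sphereKernel_radius {r t l φ : ℝ} (htr : t < r) (hl : 0 < l) (hat : |l - r| < t)
    (hφ : φ ∈ Ioo 0 (Real.pi / 2)) :
    |-((t ^ 2 - |l - r| ^ 2) * (Real.sin φ * Real.cos φ)) / radius |l - r| t φ|
        * sphereKernel r t l (radius |l - r| t φ)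
      = 1 / √(2 * r * l) * (1 * mehlerFactor 1 (midpoint (invariant r t (l, 0)) φ)) := by
  have ha := abs_nonneg (l - r)
  have ht : 0 < t := ha.trans_lt hat
  have hr : 0 < r := ht.trans htr
  have hd : 0 < t ^ 2 - |l - r| ^ 2 := by nlinarith
  have hs : 0 < Real.sin φ := Real.sin_pos_of_pos_of_lt_pi hφ.1 (by linarith [hφ.2, Real.pi_pos])
  have hc : 0 < Real.cos φ := Real.cos_pos_of_mem_Ioo ⟨by linarith [hφ.1, Real.pi_pos], hφ.2⟩
  obtain ⟨h1, h2⟩ := radius_sq_pos ha hat hφ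
  have hρ : 0 < radius |l - r| t φ := Real.sqrt_pos.2 (by nlinarith)
  have hρ2 : radius |l - r| t φ ^ 2 = t ^ 2 - (t ^ 2 - |l - r| ^ 2) * Real.sin φ ^ 2 :=
    Real.sq_sqrt (by nlinarith)
  have hw := neg_one_lt_midpoint (neg_one_lt_invariant (p := (l, 0)) htr hl le_rfl ht.le) φ
  have hw' : 2 * r * l * (1 + midpoint (invariant r t (l, 0)) φ)
      = (l + r) ^ 2 - radius |l - r| t φ ^ 2 := by
    rw [hρ2, midpoint, invariant, sq_abs]
    field_simp
    ring
  generalize hw0 : midpoint (invariant r t (l, 0)) φ = w at *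
  generalize radius |l - r| t φ = ρ at *
  have hrl : 0 < 2 * r * l := by positivity
  have e1 : √(t ^ 2 - ρ ^ 2) = √(t ^ 2 - |l - r| ^ 2) * Real.sin φ := by
    rw [hρ2, sub_sub_cancel, Real.sqrt_mul hd.le, Real.sqrt_sq hs.le]
  have hcos := Real.sin_sq_add_cos_sq φ
  have hρl : |l - r| < ρ := by nlinarith
  obtain ⟨hl1, hl2⟩ := abs_lt.1 hρl
  have hρt : ρ < t := by nlinarith
  have e2 : √(l ^ 2 - (r - ρ) ^ 2) * √((r + ρ) ^ 2 - l ^ 2)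
      = √(t ^ 2 - |l - r| ^ 2) * Real.cos φ * (√(2 * r * l) * √(1 + w)) := by
    rw [← Real.sqrt_mul (by nlinarith), ← Real.sqrt_mul hrl.le, hw']
    have : (l ^ 2 - (r - ρ) ^ 2) * ((r + ρ) ^ 2 - l ^ 2)
        = (t ^ 2 - |l - r| ^ 2) * Real.cos φ ^ 2 * ((l + r) ^ 2 - ρ ^ 2) := by
      have e3 : (t ^ 2 - |l - r| ^ 2) * Real.cos φ ^ 2 = ρ ^ 2 - |l - r| ^ 2 := by
        linear_combination (t ^ 2 - |l - r| ^ 2) * hcos - hρ2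
      rw [e3, sq_abs]
      ring
    rw [this, Real.sqrt_mul (by positivity), Real.sqrt_mul hd.le, Real.sqrt_sq hc.le]
  rw [sphereKernel, e1, e2, mehlerFactor, Polynomial.eval_one, one_mul, neg_div, abs_neg,
    abs_of_pos (by positivity)]
  have hsd := Real.sqrt_pos.2 hd
  have hsw : 0 < √(1 + w) := Real.sqrt_pos.2 (by linarith)
  have hsr := Real.sqrt_pos.2 hrl
  have hdd : t ^ 2 - |l - r| ^ 2 = √(t ^ 2 - |l - r| ^ 2) ^ 2 := (Real.sq_sqrt hd.le).symm
  generalize √(t ^ 2 - |l - r| ^ 2) = D at *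
  rw [hdd]
  field_simp

/-- Integrating the kernel over the radius gives the Mehler integral of the constant `1`. -/
theorem integral_sphereKernel {r t l : ℝ} (htr : t < r) (hl : 0 < l) (hat : |l - r| < t) :
    IntegrableOn (sphereKernel r t l) (Ioc 0 t) ∧
      ∫ ρ in Ioc 0 t, sphereKernel r t l ρ
        = 1 / √(2 * r * l) * mean (fun _ => 1) (mehlerFactor 1) (invariant r t (l, 0)) := by
  have ha := abs_nonneg (l - r)
  have ht : 0 < t := ha.trans_lt hat
  have hz := neg_one_lt_invariant (p := (l, 0)) htr hl le_rfl ht.le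
  have hsub : Ioo |l - r| t ⊆ Ioc 0 t := fun ρ hρ => ⟨ha.trans_lt hρ.1, hρ.2.le⟩
  have hzero : ∀ ρ ∈ Ioc 0 t \ Ioo |l - r| t, sphereKernel r t l ρ = 0 := fun ρ hρ =>
    sphereKernel_eq_zero htr hl.le hρ.1 hρ.2
  have hderiv : ∀ φ ∈ Ioo 0 (Real.pi / 2), HasDerivWithinAt (radius |l - r| t)
      (-((t ^ 2 - |l - r| ^ 2) * (Real.sin φ * Real.cos φ)) / radius |l - r| t φ)
      (Ioo 0 (Real.pi / 2)) φ := fun φ hφ => (hasDerivAt_radius ha hat hφ).hasDerivWithinAt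
  have hint := (intervalIntegrable_mehlerFactor 1 hz).const_mul (1 / √(2 * r * l))
  rw [intervalIntegrable_iff_integrableOn_Ioo_of_le (by positivity)] at hint
  constructor
  · refine IntegrableOn.of_forall_sdiff_eq_zero (s := Ioo |l - r| t) ?_ measurableSet_Ioc hzero
    rw [← image_radius ha hat, integrableOn_image_iff_integrableOn_abs_deriv_smul measurableSet_Ioo
      hderiv (injOn_radius ha hat)]
    exact hint.congr_fun (fun φ hφ => (sphereKernel_radius htr hl hat hφ).symm) measurableSet_Ioo
  · rw [setIntegral_eq_of_subset_of_forall_sdiff_eq_zero measurableSet_Ioc hsub hzero,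
      ← image_radius ha hat, integral_image_eq_integral_abs_deriv_smul measurableSet_Ioo
      hderiv (injOn_radius ha hat), mean, ← intervalIntegral.integral_const_mul,
      intervalIntegral.integral_of_le (by positivity), integral_Ioc_eq_integral_Ioo]
    exact setIntegral_congr_fun measurableSet_Ioo fun φ hφ => sphereKernel_radius htr hl hat hφ

/-- The inner kernel has only inverse square root singularities, at the two ends. -/
theorem intervalIntegrable_inner {r ρ : ℝ} (hρ : 0 < ρ) (hρr : ρ < r) :
    IntervalIntegrable (fun l => 1 / (√(l ^ 2 - (r - ρ) ^ 2) * √((r + ρ) ^ 2 - l ^ 2))) volume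
      (r - ρ) (r + ρ) := by
  set a := r - ρ with ha
  set b := r + ρ with hb
  have ha0 : 0 < a := by linarith
  have hab : a < b := by linarith
  have hb0 : 0 < b := by linarith
  have e : ∀ x : ℝ, 0 ≤ x → x ^ (-(1 / 2) : ℝ) = 1 / √x := fun x hx => by
    rw [Real.rpow_neg hx, Real.sqrt_eq_rpow, one_div, one_div]
  have i0 : ∀ c d : ℝ, IntervalIntegrable (fun x : ℝ => x ^ (-(1 / 2) : ℝ)) volume c d := fun c d =>
    intervalIntegral.intervalIntegrable_rpow' (by norm_num)
  have i1 : IntervalIntegrable (fun l => (l - a) ^ (-(1 / 2) : ℝ)) volume a b := by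
    simpa using (i0 0 (b - a)).comp_sub_right a
  have i2 : IntervalIntegrable (fun l => (b - l) ^ (-(1 / 2) : ℝ)) volume a b := by
    simpa using (i0 (b - a) 0).comp_sub_left b
  have i3 := (i1.add i2).const_mul (1 / (√a * √b * √(b - a)))
  rw [intervalIntegrable_iff_integrableOn_Ioo_of_le hab.le] at i3 ⊢
  refine Integrable.mono' i3 (Measurable.aestronglyMeasurable (by fun_prop)) ?_
  refine (ae_restrict_iff' measurableSet_Ioo).2 (Filter.Eventually.of_forall fun l hl => ?_)
  have hla : 0 < l - a := by linarith [hl.1]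
  have hlb : 0 < b - l := by linarith [hl.2]
  rw [Real.norm_of_nonneg (by positivity), e _ hla.le, e _ hlb.le]
  have s1 : √a * √(l - a) ≤ √(l ^ 2 - a ^ 2) := by
    rw [← Real.sqrt_mul ha0.le]
    exact Real.sqrt_le_sqrt (by nlinarith)
  have s2 : √b * √(b - l) ≤ √(b ^ 2 - l ^ 2) := by
    rw [← Real.sqrt_mul hb0.le]
    exact Real.sqrt_le_sqrt (by nlinarith)
  have s3 : √(b - a) ≤ √(l - a) + √(b - l) := by
    rw [Real.sqrt_le_left (by positivity)]
    nlinarith [Real.sq_sqrt hla.le, Real.sq_sqrt hlb.le, Real.sqrt_nonneg (l - a),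
      Real.sqrt_nonneg (b - l), mul_nonneg (Real.sqrt_nonneg (l - a)) (Real.sqrt_nonneg (b - l))]
  have p1 := Real.sqrt_pos.2 hla
  have p2 := Real.sqrt_pos.2 hlb
  have p3 := Real.sqrt_pos.2 ha0
  have p4 := Real.sqrt_pos.2 hb0
  have p5 : 0 < √(b - a) := Real.sqrt_pos.2 (by linarith)
  calc 1 / (√(l ^ 2 - a ^ 2) * √(b ^ 2 - l ^ 2))
      ≤ 1 / ((√a * √(l - a)) * (√b * √(b - l))) :=
        one_div_le_one_div_of_le (by positivity) (mul_le_mul s1 s2 (by positivity) (by positivity))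
    _ = 1 / (√a * √b * √(b - a)) * (√(b - a) / (√(l - a) * √(b - l))) := by field_simp
    _ ≤ 1 / (√a * √b * √(b - a)) * ((√(l - a) + √(b - l)) / (√(l - a) * √(b - l))) := by gcongr
    _ = 1 / (√a * √b * √(b - a)) * (1 / √(l - a) + 1 / √(b - l)) := by
        field_simp
        ring

/-- Interchanging the order of integration in the double integral. -/
theorem integral_sphere_swap {r t : ℝ} (ht : 0 < t) (htr : t < r) {h : ℝ → ℝ}
    (hh : ContinuousOn h (Icc (r - t) (r + t))) :
    IntervalIntegrable (fun ρ => ρ / √(t ^ 2 - ρ ^ 2) * ∫ l in (r - ρ)..(r + ρ),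
        h l * (1 / (√(l ^ 2 - (r - ρ) ^ 2) * √((r + ρ) ^ 2 - l ^ 2)))) volume 0 t ∧
      ∫ ρ in (0 : ℝ)..t, ρ / √(t ^ 2 - ρ ^ 2) * ∫ l in (r - ρ)..(r + ρ),
        h l * (1 / (√(l ^ 2 - (r - ρ) ^ 2) * √((r + ρ) ^ 2 - l ^ 2)))
      = ∫ l in (r - t)..(r + t), h l * (1 / √(2 * r * l)
          * mean (fun _ => 1) (mehlerFactor 1) (invariant r t (l, 0))) := by
  have hr := ht.trans htr
  have hle : r - t ≤ r + t := by linarith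
  -- the open interval: at `λ = r ± t` the kernel vanishes identically in `ρ`, while `W` does not
  set μ : Measure ℝ := volume.restrict (Ioo (r - t) (r + t)) with hμ
  set ν : Measure ℝ := volume.restrict (Ioc 0 t) with hν
  set W : ℝ → ℝ := fun l => 1 / √(2 * r * l)
    * mean (fun _ => 1) (mehlerFactor 1) (invariant r t (l, 0)) with hW
  have hpos : ∀ l ∈ Icc (r - t) (r + t), 0 < l := fun l hl => by linarith [hl.1]
  have hker : ∀ l ∈ Ioo (r - t) (r + t), Integrable (sphereKernel r t l) ν ∧
      ∫ ρ, sphereKernel r t l ρ ∂ν = W l := fun l hl =>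
    integral_sphereKernel htr (hpos l (Ioo_subset_Icc_self hl))
      (abs_lt.2 ⟨by linarith [hl.1], by linarith [hl.2]⟩)
  have hWc : ContinuousOn W (Icc (r - t) (r + t)) := by
    have hz : ContinuousOn (fun l => invariant r t (l, 0)) (Icc (r - t) (r + t)) := fun l hl =>
      (hasDerivAt_invariant_space t 0 hr (hpos l hl)).continuousAt.continuousWithinAt
    refine ContinuousOn.mul (ContinuousOn.div continuousOn_const (by fun_prop) fun l hl => ?_)
      ((continuousOn_mean continuous_const fun w hw =>
        (hasDerivAt_mehlerFactor 1 hw).continuousAt.continuousWithinAt).comp hz fun l hl =>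
          neg_one_lt_invariant htr (hpos l hl) le_rfl ht.le)
    have := hpos l hl
    positivity
  have hG : Integrable (Function.uncurry fun l ρ => h l * sphereKernel r t l ρ) (μ.prod ν) := by
    rw [integrable_prod_iff]
    · constructor
      · refine (ae_restrict_iff' measurableSet_Ioo).2 (Filter.Eventually.of_forall fun l hl => ?_)
        exact (hker l hl).1.const_mul (h l)
      · have hi : IntegrableOn (fun l => |h l| * W l) (Ioo (r - t) (r + t)) :=
          ((hh.abs.mul hWc).integrableOn_Icc).mono_set Ioo_subset_Icc_self
        refine hi.congr_fun (fun l hl => ?_) measurableSet_Ioo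
        simp only [Function.uncurry]
        rw [← (hker l hl).2, ← integral_const_mul]
        refine setIntegral_congr_fun measurableSet_Ioc fun ρ hρ => ?_
        simp only [Real.norm_eq_abs]
        rw [abs_mul, abs_of_nonneg (sphereKernel_nonneg hρ.1.le)]
    · exact (((hh.mono Ioo_subset_Icc_self).aestronglyMeasurable measurableSet_Ioo).comp_fst).mul
        (measurable_sphereKernel r t).aestronglyMeasurable
  have hinner : ∀ ρ ∈ Ioc 0 t, ∫ l, h l * sphereKernel r t l ρ ∂μ
      = ρ / √(t ^ 2 - ρ ^ 2) * ∫ l in (r - ρ)..(r + ρ),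
        h l * (1 / (√(l ^ 2 - (r - ρ) ^ 2) * √((r + ρ) ^ 2 - l ^ 2))) := by
    intro ρ hρ
    rw [intervalIntegral.integral_of_le (by linarith [hρ.1]), integral_Ioc_eq_integral_Ioo,
      ← integral_const_mul]
    have hsub : Ioo (r - ρ) (r + ρ) ⊆ Ioo (r - t) (r + t) :=
      Ioo_subset_Ioo (by linarith [hρ.2]) (by linarith [hρ.2])
    rw [hμ, setIntegral_eq_of_subset_of_forall_sdiff_eq_zero measurableSet_Ioo hsub]
    · refine setIntegral_congr_fun measurableSet_Ioo fun l _ => ?_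
      simp only [sphereKernel]
      ring
    · intro l hl
      have h1 : ρ ≤ |l - r| := by
        by_contra hcon
        obtain ⟨h2, h3⟩ := abs_lt.1 (not_le.1 hcon)
        exact hl.2 ⟨by linarith, by linarith⟩
      rw [sphereKernel_eq_zero htr (hpos l (Ioo_subset_Icc_self hl.1)).le hρ
        fun h2 => (not_lt.2 h1) h2.1, mul_zero]
  constructor
  · rw [intervalIntegrable_iff_integrableOn_Ioc_of_le ht.le]
    exact IntegrableOn.congr_fun hG.integral_prod_right hinner measurableSet_Ioc
  · rw [intervalIntegral.integral_of_le ht.le, intervalIntegral.integral_of_le hle,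
      integral_Ioc_eq_integral_Ioo (x := r - t), ← setIntegral_congr_fun measurableSet_Ioc hinner,
      ← integral_integral_swap hG]
    refine setIntegral_congr_fun measurableSet_Ioo fun l hl => ?_
    rw [integral_const_mul, (hker l hl).2]

/-! ### Even space dimensions -/

theorem mehler_one_nonneg {z : ℝ} : 0 ≤ mehler 1 z := by
  refine mul_nonneg (by positivity) (intervalIntegral.integral_nonneg (by positivity) fun φ _ => ?_)
  simp only [mehlerFactor, Polynomial.eval_one]
  positivity

theorem rpow_int_add_half {m : ℕ} (hm : 1 ≤ m) {x : ℝ} (hx : 0 < x) :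
    x ^ ((((m : ℤ) - 1 : ℤ) : ℝ) + 1 / 2) = x ^ (m - 1) * √x := by
  rw [Real.rpow_add hx, Real.sqrt_eq_rpow, ← Real.rpow_natCast, Nat.cast_sub hm]
  push_cast
  rfl

theorem intervalIntegrable_evenIntegrand {m : ℕ} {ζ r t ρ : ℝ} {f g : ℝ → ℝ} (htr : t < r)
    (hh : ContinuousOn (fun l => (-2 * C2 m ζ * (f l / l) - 2 * |deriv f l| + g l) * l ^ m)
      (Icc (r - t) (r + t))) (hρ : ρ ∈ Ioc 0 t) :
    IntervalIntegrable (evenIntegrand m ζ f g r ρ) volume (r - ρ) (r + ρ) := by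
  have h := (intervalIntegrable_inner hρ.1 (hρ.2.trans_lt htr)).continuousOn_mul
    (hh.mono (by
      rw [uIcc_of_le (by linarith [hρ.1])]
      exact Icc_subset_Icc (by linarith [hρ.2]) (by linarith [hρ.2])))
  refine h.congr fun l _ => ?_
  simp only [evenIntegrand]
  ring

/-- The integrand of Riemann's representation dominates the one of the lower bound. The term with
`K'` is absorbed by `C_{2,m}`, because `t / r ≤ ζ / 2`. -/
theorem even_integrand_le {m : ℕ} (hm : 2 ≤ m) {ζ r t l : ℝ} (hζ : ChebyshevConst m ζ) {f g : ℝ → ℝ}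
    (ht : 0 < t) (htr : t < r) (hζr : 2 / ζ * t ≤ r - t) (hl : l ∈ Icc (r - t) (r + t))
    (hf : 0 ≤ f l) (hg : 0 ≤ g l) :
    mehler 1 (invariant r t (l, 0))
        * (1 / 2 * (-2 * C2 m ζ * (f l / l) - 2 * |deriv f l| + g l))
      ≤ mehler (Polynomial.Chebyshev.T ℝ ((m : ℤ) - 1)) (invariant r t (l, 0)) * g l
        - deriv (mehler (Polynomial.Chebyshev.T ℝ ((m : ℤ) - 1))) (invariant r t (l, 0))
          * (t / (r * l)) * f l := by
  have hζ0 := hζ.1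
  have hr := ht.trans htr
  have hl0 : 0 < l := by linarith [hl.1]
  have hm' : (2 : ℝ) ≤ m := by exact_mod_cast hm
  set b : ℝ := ((m : ℝ) - 1) ^ 2 with hb
  have hb0 : 0 ≤ b := sq_nonneg _
  obtain ⟨h1, h2⟩ := mehler_bounds (a := 1 / (1 + ζ)) (b := b)
    (by have : 0 < 1 / (1 + ζ) := by positivity
        linarith)
    (fun w hw => ⟨(hζ.2 w hw).1, (hζ.2 w hw).2.2.2⟩) hb0
    (invariant_mem_Icc hζ0 ht (by linarith) hζr hl)
  have hM := mehler_one_nonneg (z := invariant r t (l, 0))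
  generalize mehler 1 (invariant r t (l, 0)) = M at *
  have e1 := mul_le_mul_of_nonneg_right h1 hg
  have e2 : t / (r * l) ≤ ζ / 2 / l := by
    rw [div_le_div_iff₀ (by positivity) hl0]
    rw [div_mul_eq_mul_div, div_le_iff₀ hζ0] at hζr
    nlinarith [mul_pos ht hl0, mul_pos hζ0 hl0, mul_pos hζ0 ht]
  have hfl : 0 ≤ f l / l := div_nonneg hf hl0.le
  have e3 : deriv (mehler (Polynomial.Chebyshev.T ℝ ((m : ℤ) - 1))) (invariant r t (l, 0))
      * (t / (r * l)) * f l ≤ M * (C2 m ζ * (f l / l)) := by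
    calc _ ≤ b * M * (t / (r * l)) * f l := by gcongr
      _ ≤ b * M * (ζ / 2 / l) * f l := by gcongr
      _ = M * (b * ζ / 2 * (f l / l)) := by ring
      _ ≤ M * (C2 m ζ * (f l / l)) := by
          gcongr
          have : 0 ≤ b * ζ := by positivity
          rw [C2, ← hb]
          linarith
  have e4 : 0 ≤ M * |deriv f l| := by positivity
  linarith

theorem even_lower_bound {m : ℕ} (hm : 2 ≤ m) {ζ R r t : ℝ} (hζ : ChebyshevConst m ζ) (hR : 0 < R)
    {f g : ℝ → ℝ} {u : ℝ → ℝ → ℝ} (hf : ContinuousOn f (Ioi 0)) (hg : ContinuousOn g (Ioi 0))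
    (hf' : ContinuousOn (deriv f) (Ioi 0)) (hu : IsRadialFreeSolution (2 * m) f g u)
    (hf0 : ∀ l ≥ R, 0 ≤ f l) (hg0 : ∀ l ≥ R, 0 ≤ g l)
    (ht : 0 < t) (hRr : R ≤ r - t) (hζr : 2 / ζ * t ≤ r - t) :
    (∀ ρ ∈ Ioc 0 t, IntervalIntegrable (evenIntegrand m ζ f g r ρ) volume (r - ρ) (r + ρ)) ∧
      IntervalIntegrable (evenOuter m ζ f g r t) volume 0 t ∧
      1 / (Real.pi * r ^ (m - 1)) * ∫ ρ in (0 : ℝ)..t, evenOuter m ζ f g r t ρ ≤ u r t := by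
  have htr : t < r := by linarith
  have hr : 0 < r := ht.trans htr
  have hpos : ∀ l ∈ Icc (r - t) (r + t), 0 < l := fun l hl => by linarith [hl.1]
  have hsub : Icc (r - t) (r + t) ⊆ Ioi 0 := hpos
  have hle : r - t ≤ r + t := by linarith
  have hh0 : ContinuousOn (fun l => -2 * C2 m ζ * (f l / l) - 2 * |deriv f l| + g l)
      (Icc (r - t) (r + t)) :=
    ((continuousOn_const.mul ((hf.mono hsub).div continuousOn_id fun l hl => (hpos l hl).ne')).sub
      (continuousOn_const.mul (hf'.mono hsub).abs)).add (hg.mono hsub)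
  have hh : ContinuousOn (fun l => (-2 * C2 m ζ * (f l / l) - 2 * |deriv f l| + g l) * l ^ m)
      (Icc (r - t) (r + t)) := hh0.mul (by fun_prop)
  have houter : (fun ρ => ρ / √(t ^ 2 - ρ ^ 2) * ∫ l in (r - ρ)..(r + ρ),
      (-2 * C2 m ζ * (f l / l) - 2 * |deriv f l| + g l) * l ^ m
        * (1 / (√(l ^ 2 - (r - ρ) ^ 2) * √((r + ρ) ^ 2 - l ^ 2)))) = evenOuter m ζ f g r t := by
    ext ρ
    rw [evenOuter]
    congr 2
    ext l
    rw [evenIntegrand]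
    ring
  have hswap := integral_sphere_swap ht htr hh
  rw [houter] at hswap
  refine ⟨fun ρ hρ => intervalIntegrable_evenIntegrand htr hh hρ, hswap.1, ?_⟩
  have hM : ContinuousOn (fun l => mehler 1 (invariant r t (l, 0))) (Icc (r - t) (r + t)) := by
    intro l hl
    have hz := neg_one_lt_invariant (p := (l, 0)) htr (hpos l hl) le_rfl ht.le
    exact ((hasDerivAt_mehler 1 hz).comp (h := fun l => invariant r t (l, 0)) l
      (hasDerivAt_invariant_space t 0 hr (hpos l hl))).continuousAt.continuousWithinAt
  have key := representation_lower_bound hu (isRiemannFunction_mehler ((m : ℤ) - 1))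
    (by push_cast; ring) ht htr hf hg (hM.mul (continuousOn_const.mul hh0)) fun l hl =>
      even_integrand_le hm hζ ht htr hζr hl (hf0 l (hRr.trans hl.1)) (hg0 l (hRr.trans hl.1))
  have hm1 : 1 ≤ m := by omega
  have hrα := rpow_int_add_half hm1 hr
  have hb1 : 0 ≤ (r + t) ^ ((((m : ℤ) - 1 : ℤ) : ℝ) + 1 / 2) * f (r + t) :=
    mul_nonneg (Real.rpow_nonneg (by linarith) _) (hf0 _ (by linarith))
  have hb2 : 0 ≤ (r - t) ^ ((((m : ℤ) - 1 : ℤ) : ℝ) + 1 / 2) * f (r - t) :=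
    mul_nonneg (Real.rpow_nonneg (by linarith) _) (hf0 _ hRr)
  have key' := (le_add_of_nonneg_left (add_nonneg hb1 hb2)).trans key
  have hsr : 0 < √r := Real.sqrt_pos.2 hr
  rw [hrα] at key'
  have hu' : u r t = 1 / (2 * (r ^ (m - 1) * √r)) * (2 * (r ^ (m - 1) * √r * u r t)) := by
    field_simp
  rw [hu']
  refine le_trans (le_of_eq ?_) (mul_le_mul_of_nonneg_left key' (by positivity))
  rw [hswap.2, ← intervalIntegral.integral_const_mul, ← intervalIntegral.integral_const_mul]
  refine intervalIntegral.integral_congr fun l hl => ?_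
  rw [uIcc_of_le hle] at hl
  have hl0 := hpos l hl
  have hsl : 0 < √l := Real.sqrt_pos.2 hl0
  have h2 : 0 < √(2 : ℝ) := by positivity
  have hpi := Real.pi_pos
  have e1 : l ^ m = l ^ (m - 1) * √l ^ 2 := by
    rw [Real.sq_sqrt hl0.le, ← pow_succ, Nat.sub_add_cancel hm1]
  have e2 : √(2 * r * l) = √2 * √r * √l := by
    rw [Real.sqrt_mul (by positivity), Real.sqrt_mul (by positivity)]
  have e3 : √(2 : ℝ) ^ 2 = 2 := Real.sq_sqrt (by norm_num)
  simp only [Pi.mul_apply]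
  rw [rpow_int_add_half hm1 hl0, e1, e2, mehler]
  generalize mean (fun _ => 1) (mehlerFactor 1) (invariant r t (l, 0)) = A
  generalize -2 * C2 m ζ * (f l / l) - 2 * |deriv f l| + g l = B
  field_simp
  rw [e3]
  ring

end RadialWave

end

theorem mainTheorem3 (m : ℕ) (hm : 2 ≤ m) :
    (∃ η, RadialWave.LegendreConst m η) ∧ (∃ ζ, RadialWave.ChebyshevConst m ζ) ∧
    ∀ η ζ : ℝ, RadialWave.LegendreConst m η → RadialWave.ChebyshevConst m ζ →
    ∀ R κ : ℝ, 0 < R → 0 < κ →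
    ∀ f g : ℝ → ℝ, ContDiffOn ℝ 2 f (Set.Ioi 0) → ContDiffOn ℝ 1 g (Set.Ioi 0) →
    ∀ u : ℝ → ℝ → ℝ,
      (RadialWave.IsRadialFreeSolution (2 * m + 1) f g u →
        RadialWave.OddData1 m R κ f g ∨ RadialWave.OddData2 m R κ f g →
        ∀ r t : ℝ, (r, t) ∈ RadialWave.Sigma1 R (RadialWave.delta η ζ) →
          1 / (2 * r ^ m) * (f (r + t) * (r + t) ^ m + f (r - t) * (r - t) ^ m)
            + 1 / (4 * r ^ m) *
              ∫ l in (r - t)..(r + t), l ^ m * (-RadialWave.C1 m * (f l / l) + g l)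
          ≤ u r t) ∧
      (RadialWave.IsRadialFreeSolution (2 * m) f g u →
        RadialWave.EvenData m ζ R κ f g →
        ∀ r t : ℝ, (r, t) ∈ RadialWave.Sigma1 R (RadialWave.delta η ζ) →
          (∀ ρ ∈ Set.Ioc 0 t, IntervalIntegrable (RadialWave.evenIntegrand m ζ f g r ρ)
            MeasureTheory.volume (r - ρ) (r + ρ)) ∧
          IntervalIntegrable (RadialWave.evenOuter m ζ f g r t) MeasureTheory.volume 0 t ∧
          1 / (Real.pi * r ^ (m - 1)) * ∫ ρ in (0 : ℝ)..t, RadialWave.evenOuter m ζ f g r t ρ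
          ≤ u r t) := by
  refine ⟨RadialWave.exists_legendreConst hm, RadialWave.exists_chebyshevConst hm, ?_⟩
  intro η ζ hη hζ R κ hR _ f g hf hg u
  have hfc := hf.continuousOn
  have hf' : ContinuousOn (deriv f) (Ioi 0) := hf.continuousOn_deriv_of_isOpen isOpen_Ioi (by simp)
  constructor
  · intro hu hdata r t hrt
    obtain ⟨ht, -, hRr, hηr, -⟩ := RadialWave.sigma1_bounds hR hrt
    have hfg : (∀ l ≥ R, 0 ≤ f l) ∧ ∀ l ≥ R, 0 ≤ g l := by
      rcases hdata with ⟨c, hc, h⟩ | ⟨c, hc, h⟩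
      · refine ⟨fun l hl => le_trans ?_ (h l hl).1, fun l hl => (h l hl).2.1.le⟩
        have : 0 < 1 + l := by linarith
        positivity
      · exact ⟨fun l hl => (h l hl).1.le, fun l hl => (h l hl).2.1.le⟩
    exact RadialWave.odd_lower_bound hm hη hR hfc hg.continuousOn hu hfg.1 hfg.2 ht hRr hηr
  · rintro hu ⟨c, hc, h⟩ r t hrt
    obtain ⟨ht, -, hRr, -, hζr⟩ := RadialWave.sigma1_bounds hR hrt
    exact RadialWave.even_lower_bound hm hζ hR hfc hg.continuousOn hf' hu
      (fun l hl => (h l hl).1.le) (fun l hl => (h l hl).2.1.le) ht hRr hζr
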